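/- **Theorem 2.1.** Consider the scalar system $$y_{t+1}=\theta f(y_t)+u_t+w_{t+1},\qquad t\ge 0,$$ where $f:\mathbb{R}\to\mathbb{R}$ is a known piecewise continuous function (finitely many discontinuities in each bounded interval), $\{w_t\}_{t\ge1}$ is an i.i.d. sequence with $w_1\sim N(0,1)$, the unknown parameter $\theta\sim N(\theta_0,P_0)$, $P_0>0$, is independent of $\{w_t\}$, and the initial value $y_0$ is independent of $(\theta,\{w_t\})$. Suppose that (i) for some $k_1,k_2>0$, $|f(x)|\le k_1e^{k_2|x|}$ for all $x\in\mathbb{R}$; (ii) there are real numbers $b<4$ and $L>0$ such that the set $S_b^L=\{x:|f(x)|<L|x|^b\}$ satisfies $$\liminf_{l\to+\infty}\frac{\ell(S_b^L\cap[-l,l])}{l}>0,$$ where $\ell$ denotes the Lebesgue measure. Then the system is globally stabilizable: there is a feedback control law $u_t\in\sigma\{y_i,\,0\le i\le t\}$, $t\ge0$ (that is, $u_t=U_t(y_0,\dots,y_t)$ with Borel functions $U_t$ not depending on the initial value), such that for every initial value $y_0$ (in particular, every deterministic $y_0\in\mathbb{R}$) $$\sup_{t\ge1}\frac1t\sum_{i=1}^t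 y_i^2<+\infty\quad\text{almost surely.}$$ Moreover, the least-squares certainty-equivalence control $u_t=-\theta_tf(y_t)$ is such a law, where, started from $(\theta_0,P_0)$ and with $\phi_t=f(y_t)$, $a_t=(1+P_t\phi_t^2)^{-1}$, $$\theta_{t+1}=\theta_t+a_tP_t\phi_t\,(y_{t+1}-u_t-\phi_t\theta_t),\qquad P_{t+1}=P_t-a_tP_t^2\phi_t^2.$$ -/

import Mathlib

open MeasureTheory ProbabilityTheory Filter
open scoped ENNReal NNReal

/-- `f : ℝ → ℝ` is piecewise continuous: every bounded interval contains only finitely many points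
of discontinuity of `f`.  (One-sided limits at these points are not required.) -/
def PiecewiseContinuous (f : ℝ → ℝ) : Prop :=
  ∀ a b : ℝ, ({x : ℝ | ¬ ContinuousAt f x} ∩ Set.Icc a b).Finite

/-- The set `S_b^L = {x : |f x| < L |x|^b}`. -/
def growthSet (f : ℝ → ℝ) (b L : ℝ) : Set ℝ :=
  {x : ℝ | |f x| < L * |x| ^ b}

/-- A feedback control law: `u_t` is a Borel function of the observed outputs `y_0, …, y_t`,
that is, `u_t` is measurable with respect to `σ(y_i, 0 ≤ i ≤ t)`. -/
def IsFeedbackLaw (U : (t : ℕ) → (Fin (t + 1) → ℝ) → ℝ) : Prop :=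
  ∀ t : ℕ, Measurable (U t)

/-- `y` is an output process of the system `y_{t+1} = θ f(y_t) + u_t + w_{t+1}`, `t ≥ 0`, in closed
loop with the control law `u_t = U t (y_0, …, y_t)`. -/
def IsClosedLoop {Ω : Type*} (f : ℝ → ℝ) (θ : Ω → ℝ) (w : ℕ → Ω → ℝ)
    (U : (t : ℕ) → (Fin (t + 1) → ℝ) → ℝ) (y : ℕ → Ω → ℝ) : Prop :=
  ∀ (t : ℕ) (ω : Ω),
    y (t + 1) ω = θ ω * f (y t ω) + U t (fun i : Fin (t + 1) => y i ω) + w (t + 1) ω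

/-- The control law `U` stabilizes the system: whatever the initial value `y_0`, random and
independent of the parameter and the noise (in particular, whatever the constant `y_0 ∈ ℝ`),
`sup_{t ≥ 1} (1/t) ∑_{i=1}^t y_i² < ∞` almost surely. -/
def Stabilizes {Ω : Type*} [MeasurableSpace Ω] (μ : Measure Ω) (f : ℝ → ℝ) (θ : Ω → ℝ)
    (w : ℕ → Ω → ℝ) (U : (t : ℕ) → (Fin (t + 1) → ℝ) → ℝ) : Prop :=
  ∀ y : ℕ → Ω → ℝ,
    Measurable (y 0) →
    IndepFun (y 0) (fun ω => (θ ω, fun t : ℕ => w (t + 1) ω)) μ →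
    IsClosedLoop f θ w U y →
    ∀ᵐ ω ∂μ, ∃ C : ℝ, ∀ t : ℕ, 1 ≤ t → (1 / (t : ℝ)) * ∑ i ∈ Finset.Icc 1 t, (y i ω) ^ 2 ≤ C

/-- Global stabilizability: one feedback control law stabilizes the system for every initial
value. -/
def GloballyStabilizable {Ω : Type*} [MeasurableSpace Ω] (μ : Measure Ω) (f : ℝ → ℝ) (θ : Ω → ℝ)
    (w : ℕ → Ω → ℝ) : Prop :=
  ∃ U : (t : ℕ) → (Fin (t + 1) → ℝ) → ℝ, IsFeedbackLaw U ∧ Stabilizes μ f θ w U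

/-- The state `(θ_t, P_t)` of the recursive least-squares algorithm started at `(θ₀, P₀)`, as a
function of the outputs `y_0, …, y_t`, when the inputs are `u_t = -θ_t f(y_t)`:
`θ_{t+1} = θ_t + a_t P_t φ_t (y_{t+1} - u_t - φ_t θ_t)`, `P_{t+1} = P_t - a_t P_t φ_t φ_t P_t`,
with `φ_t = f(y_t)` and `a_t = (1 + φ_t P_t φ_t)⁻¹`. -/
noncomputable def lsState (f : ℝ → ℝ) (θ₀ P₀ : ℝ) : (t : ℕ) → (Fin (t + 1) → ℝ) → ℝ × ℝ
  | 0, _ => (θ₀, P₀)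
  | t + 1, h =>
    let past : Fin (t + 1) → ℝ := fun i => h i.castSucc
    let est : ℝ := (lsState f θ₀ P₀ t past).1
    let P : ℝ := (lsState f θ₀ P₀ t past).2
    let φ : ℝ := f (past (Fin.last t))
    let u : ℝ := -est * φ
    let a : ℝ := (1 + φ * P * φ)⁻¹
    (est + a * P * φ * (h (Fin.last (t + 1)) - u - φ * est), P - a * P * φ * φ * P)

/-- The least-squares certainty-equivalence control `u_t = -θ_t f(y_t)`. -/
noncomputable def lsControl (f : ℝ → ℝ) (θ₀ P₀ : ℝ) (t : ℕ) (h : Fin (t + 1) → ℝ) : ℝ :=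
  -(lsState f θ₀ P₀ t h).1 * f (h (Fin.last t))

/-! Under the certainty-equivalence control, `y_{t+1} = φ_t (θ - θ_t) + w_{t+1}`. Given the past
this is centred Gaussian with variance `ρ_t = 1 + φ_t² P_t`, and `1 / P_{t+1} = 1 / P_t + φ_t²`. So
`(φ, r) = (f(y), 1 / P)` follows a recursion driven by the innovations `e_t = y_{t+1} / √ρ_t`. These
are i.i.d. standard Gaussian and independent of `y_0` (`measurePreserving_initial_innovationSeq`),
because each filter step rotates the pair (normalized estimation error, fresh noise). By the strong
law for `e_t²` it remains to show that `ρ_t` is almost surely bounded (`ae_mem_boundedVar`).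

Boundedness is a tail event, so by Lévy's zero-one argument (`ae_mem_of_forall_le_iidSeq`) a lower
bound for its probability, uniform over the states with `r ≥ 1 / P₀`, is enough. Two regimes are
treated.

If `ρ ≤ K` and `R = r + φ²` is large, `1 / R` is superharmonic until the variance exceeds `K`: the
information grows by a fixed amount with a fixed probability, a gain of order `R⁻²`, while exit has
probability `O(R⁻³)` (`exists_half_le_boundedVar`). If `R` is not large, finitely many favourable
steps make it so.

If `ρ` is large, the density condition gives `φ_{t+1}² ≤ C ρ_t^b` with probability bounded below. As
`ρ_t = r_{t+1} / r_t`, the logarithms `z_t` of the information satisfy roughly `z_{t+2} ≤ b (z_{t+1}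
- z_t)`, so a ratio `m` of successive terms is followed by at most `b - b / m`. For `0 < b < 4`, `m
+ b / m ≥ 2√b > b`, so the ratio falls by a fixed amount per step (`exists_logInfo_contraction`). It
cannot fall below `1`, hence boundedly many favourable steps bring the variance below `K`. -/

/-! ### Sequences of i.i.d. random elements -/

section Sequences

variable {α : Type*}

/-- The sequence `x, e 0, e 1, …`. -/
def consSeq (x : α) (e : ℕ → α) : ℕ → α
  | 0 => x
  | n + 1 => e n

/-- The sequence `e 1, e 2, …`. -/
def tailSeq (e : ℕ → α) : ℕ → α := fun n => e (n + 1)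

@[simp] lemma consSeq_zero (x : α) (e : ℕ → α) : consSeq x e 0 = x := rfl

@[simp] lemma consSeq_succ (x : α) (e : ℕ → α) (n : ℕ) : consSeq x e (n + 1) = e n := rfl

@[simp] lemma tailSeq_apply (e : ℕ → α) (n : ℕ) : tailSeq e n = e (n + 1) := rfl

lemma box_succ (n : ℕ) (t : ℕ → Set α) (x : α) (e : ℕ → α) :
    (∀ i < n + 1, consSeq x e i ∈ t i) ↔ x ∈ t 0 ∧ ∀ i < n, e i ∈ t (i + 1) := by
  constructor
  · intro h
    exact ⟨h 0 n.succ_pos, fun i hi => h (i + 1) (by omega)⟩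
  · rintro ⟨h0, h⟩ i hi
    cases i with
    | zero => exact h0
    | succ i => exact h i (by omega)

variable [MeasurableSpace α]

lemma measurable_consSeq : Measurable fun p : α × (ℕ → α) => consSeq p.1 p.2 := by
  refine measurable_pi_lambda _ fun n => ?_
  cases n with
  | zero => exact measurable_fst
  | succ n => exact (measurable_pi_apply n).comp measurable_snd

@[fun_prop] lemma measurable_tailSeq : Measurable (tailSeq : (ℕ → α) → ℕ → α) :=
  measurable_pi_lambda _ fun n => measurable_pi_apply (n + 1)

variable (ν : Measure α) [IsProbabilityMeasure ν]

/-- The law of a sequence of independent random elements with law `ν`. -/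
noncomputable def iidSeq : Measure (ℕ → α) := Measure.infinitePi fun _ : ℕ => ν

instance : IsProbabilityMeasure (iidSeq ν) := by unfold iidSeq; infer_instance

/-- A measure on sequences is the law of an i.i.d. sequence if it has the right values on boxes
over the initial segments of the index set. -/
lemma eq_iidSeq {m : Measure (ℕ → α)}
    (h : ∀ (n : ℕ) (t : ℕ → Set α), (∀ i, MeasurableSet (t i)) →
      m {e | ∀ i < n, e i ∈ t i} = ∏ i ∈ Finset.range n, ν (t i)) : m = iidSeq ν := by
  classical
  refine Measure.eq_infinitePi (fun _ => ν) fun s t ht => ?_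
  obtain ⟨n, hn⟩ := s.exists_nat_subset_range
  have := h n (fun i => if i ∈ s then t i else Set.univ) fun i => by
    by_cases hi : i ∈ s <;> simp [hi, ht]
  have h1 : {e : ℕ → α | ∀ i < n, e i ∈ if i ∈ s then t i else Set.univ} = Set.pi s t := by
    ext e
    simp only [Set.mem_ofPred_eq, Set.mem_pi, Finset.mem_coe]
    constructor
    · intro he i hi
      simpa [hi] using he i (by simpa using hn hi)
    · intro he i _
      by_cases hi : i ∈ s
      · simpa [hi] using he i hi
      · simp [hi]
  rw [h1] at this
  rw [this, ← Finset.prod_subset hn]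
  · exact Finset.prod_congr rfl fun i hi => by simp [hi]
  · intro i _ hi; simp [hi]

lemma iidSeq_box (n : ℕ) (t : ℕ → Set α) (ht : ∀ i, MeasurableSet (t i)) :
    iidSeq ν {e | ∀ i < n, e i ∈ t i} = ∏ i ∈ Finset.range n, ν (t i) := by
  have := Measure.infinitePi_pi (fun _ : ℕ => ν) (s := Finset.range n) (t := t) fun i _ => ht i
  rw [← this]
  unfold iidSeq
  congr 1
  ext e
  simp [Set.mem_pi]

lemma measurableSet_box (n : ℕ) (t : ℕ → Set α) (ht : ∀ i, MeasurableSet (t i)) :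
    MeasurableSet {e : ℕ → α | ∀ i < n, e i ∈ t i} := by
  simp only [Set.ofPred_forall]
  exact MeasurableSet.iInter fun i => MeasurableSet.iInter fun _ => measurable_pi_apply i (ht i)

lemma measurePreserving_consSeq :
    MeasurePreserving (fun p : α × (ℕ → α) => consSeq p.1 p.2) (ν.prod (iidSeq ν)) (iidSeq ν) := by
  refine ⟨measurable_consSeq, eq_iidSeq ν fun n t ht => ?_⟩
  rw [Measure.map_apply measurable_consSeq (measurableSet_box n t ht)]
  cases n with
  | zero => simp
  | succ n =>
    have : (fun p : α × (ℕ → α) => consSeq p.1 p.2) ⁻¹' {e | ∀ i < n + 1, e i ∈ t i}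
        = t 0 ×ˢ {e | ∀ i < n, e i ∈ t (i + 1)} := by
      ext ⟨x, e⟩
      exact box_succ n t x e
    rw [this, Measure.prod_prod, iidSeq_box ν n _ fun i => ht (i + 1), Finset.prod_range_succ',
      mul_comm]

lemma measurePreserving_splitSeq :
    MeasurePreserving (fun e : ℕ → α => (e 0, tailSeq e)) (iidSeq ν) (ν.prod (iidSeq ν)) := by
  have hm : Measurable fun e : ℕ → α => (e 0, tailSeq e) :=
    (measurable_pi_apply 0).prodMk measurable_tailSeq
  refine ⟨hm, ?_⟩
  conv_lhs => rw [← (measurePreserving_consSeq ν).map_eq]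
  rw [Measure.map_map hm measurable_consSeq]
  exact Measure.map_id

/-- Conditioning on the first term of an i.i.d. sequence. -/
lemma iidSeq_apply {A : Set (ℕ → α)} (hA : MeasurableSet A) :
    iidSeq ν A = ∫⁻ x, iidSeq ν {e | consSeq x e ∈ A} ∂ν := by
  rw [← (measurePreserving_consSeq ν).measure_preimage hA.nullMeasurableSet,
    Measure.prod_apply (measurable_consSeq hA)]
  rfl

end Sequences

/-! ### Random recursions -/

section Recursion

variable {S α : Type*}

/-- The states `s, G s (e 0), G (G s (e 0)) (e 1), …` of the recursion driven by `e`. -/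
def orbit (G : S → α → S) : S → (ℕ → α) → ℕ → S
  | s, _, 0 => s
  | s, e, n + 1 => orbit G (G s (e 0)) (tailSeq e) n

@[simp] lemma orbit_zero (G : S → α → S) (s : S) (e : ℕ → α) : orbit G s e 0 = s := rfl

lemma orbit_succ (G : S → α → S) (s : S) (e : ℕ → α) (n : ℕ) :
    orbit G s e (n + 1) = orbit G (G s (e 0)) (tailSeq e) n := rfl

/-- `orbit` peels off the first noise term, which suits conditioning on it; measurability is easier
from the last step. -/
lemma orbit_succ_last (G : S → α → S) (s : S) (e : ℕ → α) (n : ℕ) :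
    orbit G s e (n + 1) = G (orbit G s e n) (e n) := by
  induction n generalizing s e with
  | zero => rfl
  | succ n ih => rw [orbit_succ, ih]; rfl

variable [MeasurableSpace α]

variable (ν : Measure α) [IsProbabilityMeasure ν]

/-- Once the first `n` terms are fixed, `A s` becomes the event `A` of the state reached, which is
still in `D`. So `q` bounds the conditional probability of `A s` given these terms. -/
lemma iidSeq_inter_compl_le {G : S → α → S} {D : Set S}
    (hD : ∀ s ∈ D, ∀ x, G s x ∈ D) {A : S → Set (ℕ → α)} (hAm : ∀ s ∈ D, MeasurableSet (A s))
    (hA : ∀ s x e, consSeq x e ∈ A s ↔ e ∈ A (G s x)) {q : ℝ≥0∞}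
    (hq : ∀ s ∈ D, iidSeq ν (A s) ≤ q) (n : ℕ) :
    ∀ s ∈ D, ∀ C : Set (ℕ → α), MeasurableSet C →
      (∀ e e' : ℕ → α, (∀ i < n, e i = e' i) → e ∈ C → e' ∈ C) →
      iidSeq ν (A s ∩ C) ≤ q * iidSeq ν C := by
  induction n with
  | zero =>
    intro s hs C _ hC
    rcases C.eq_empty_or_nonempty with rfl | ⟨e, he⟩
    · simp
    · have : C = Set.univ := Set.eq_univ_of_forall fun e' => hC e e' (by simp) he
      simpa [this] using hq s hs
  | succ n ih =>
    intro s hs C hCm hC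
    have hsec : ∀ x, MeasurableSet {e | consSeq x e ∈ C} := fun x =>
      (measurable_consSeq.comp measurable_prodMk_left) hCm
    have hmeas : Measurable fun x => iidSeq ν {e | consSeq x e ∈ C} :=
      measurable_measure_prodMk_left (measurable_consSeq hCm)
    rw [iidSeq_apply ν ((hAm s hs).inter hCm), iidSeq_apply ν hCm, ← lintegral_const_mul _ hmeas]
    refine lintegral_mono fun x => ?_
    have : {e | consSeq x e ∈ A s ∩ C} = A (G s x) ∩ {e | consSeq x e ∈ C} := by
      ext e; simp [hA]
    rw [this]
    refine ih _ (hD s hs x) _ (hsec x) fun e e' hee' he => hC _ _ (fun i hi => ?_) he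
    cases i with
    | zero => rfl
    | succ i => exact hee' i (by omega)

lemma mem_iff_of_measurableSet_piLE {n : ℕ} {C : Set (ℕ → α)}
    (hC : MeasurableSet[Filtration.piLE (X := fun _ : ℕ => α) n] C) {e e' : ℕ → α}
    (h : ∀ i ≤ n, e i = e' i) (he : e ∈ C) : e' ∈ C := by
  obtain ⟨B, _, rfl⟩ := hC
  have : Preorder.restrictLe (π := fun _ : ℕ => α) n e = Preorder.restrictLe n e' := by
    ext i; exact h i.1 i.2
  simpa [Set.mem_preimage, this] using he

lemma iSup_piLE_nat :
    ⨆ n, Filtration.piLE (X := fun _ : ℕ => α) n = (MeasurableSpace.pi : MeasurableSpace (ℕ → α)) := by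
  refine le_antisymm (iSup_le fun n => Filtration.le _ n) ?_
  refine iSup_le fun i => ?_
  refine le_trans ?_ (le_iSup _ i)
  rintro _ ⟨B, hB, rfl⟩
  exact ⟨(fun z : (j : Set.Iic i) → α => z ⟨i, Set.mem_Iic.2 (le_refl i)⟩) ⁻¹' B,
    measurable_pi_apply (⟨i, Set.mem_Iic.2 (le_refl i)⟩ : Set.Iic i) hB, rfl⟩

/-- A tail event of a random recursion whose probability is bounded away from `0` uniformly in the
initial state has probability one. -/
theorem ae_mem_of_forall_le_iidSeq {G : S → α → S} {D : Set S}
    (hD : ∀ s ∈ D, ∀ x, G s x ∈ D) {A : S → Set (ℕ → α)} (hAm : ∀ s ∈ D, MeasurableSet (A s))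
    (hA : ∀ s x e, consSeq x e ∈ A s ↔ e ∈ A (G s x)) {p : ℝ≥0∞} (hp : 0 < p)
    (hpA : ∀ s ∈ D, p ≤ iidSeq ν (A s)) : ∀ s ∈ D, ∀ᵐ e ∂iidSeq ν, e ∈ A s := by
  intro s hs
  set m := iidSeq ν
  set F := Filtration.piLE (X := fun _ : ℕ => α)
  have hp1 : p ≤ 1 := (hpA s hs).trans prob_le_one
  set q : ℝ := (1 - p).toReal with hqdef
  have hq1 : q < 1 := by
    have : (1 - p).toReal < (1 : ℝ≥0∞).toReal :=
      (ENNReal.toReal_lt_toReal (by simp) (by simp)).2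
        (ENNReal.sub_lt_self (by simp) (by simp) hp.ne')
    simpa using this
  have hAc : MeasurableSet (A s)ᶜ := (hAm s hs).compl
  -- By Lévy's upward theorem these conditional probabilities converge to the indicator of the
  -- complement. As they stay below `q < 1`, the indicator is almost surely `0`.
  have hle : ∀ n, m[(A s)ᶜ.indicator (fun _ => (1 : ℝ)) | F n] ≤ᵐ[m] fun _ => q := by
    intro n
    have hint : Integrable ((A s)ᶜ.indicator (fun _ => (1 : ℝ))) m :=
      (integrable_const _).indicator hAc
    refine ae_le_of_ae_le_trim (hm := F.le n) ?_
    refine ae_le_of_forall_setIntegral_le (integrable_condExp.trim _ stronglyMeasurable_condExp)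
      (integrable_const _) fun C hC _ => ?_
    rw [← setIntegral_trim (F.le n) stronglyMeasurable_condExp hC,
      ← setIntegral_trim (F.le n) stronglyMeasurable_const hC, setIntegral_condExp (F.le n) hint hC]
    have hCm : MeasurableSet C := F.le n C hC
    -- `F n` sees the coordinates `0, …, n`, hence `n + 1` terms.
    have key := iidSeq_inter_compl_le ν hD (A := fun s => (A s)ᶜ)
      (fun s hs => (hAm s hs).compl) (fun s x e => by simp [hA]) (q := 1 - p)
      (fun s hs => by
        rw [prob_compl_eq_one_sub (hAm s hs)]
        exact tsub_le_tsub_left (hpA s hs) 1) (n + 1) s hs C hCm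
      fun e e' hee' he => mem_iff_of_measurableSet_piLE hC (fun i hi => hee' i (by omega)) he
    rw [setIntegral_indicator hAc]
    simp only [integral_const, MeasurableSet.univ, measureReal_restrict_apply, Set.univ_inter,
      smul_eq_mul, mul_one]
    rw [Set.inter_comm, measureReal_def, measureReal_def, mul_comm, hqdef, ← ENNReal.toReal_mul]
    exact ENNReal.toReal_mono (ENNReal.mul_ne_top (by simp) (measure_ne_top _ _)) key
  have hlim := tendsto_ae_condExp (ℱ := F) (μ := m) ((A s)ᶜ.indicator (fun _ => (1 : ℝ)))
  have hsup : ⨆ n, F n = MeasurableSpace.pi := iSup_piLE_nat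
  rw [hsup, condExp_of_stronglyMeasurable le_rfl
    (stronglyMeasurable_const.indicator hAc) ((integrable_const _).indicator hAc)] at hlim
  filter_upwards [hlim, ae_all_iff.2 hle] with e he1 he2
  by_contra hcon
  have : (1 : ℝ) ≤ q := by
    refine le_of_tendsto (x := atTop) ?_ (Eventually.of_forall he2)
    simpa [Set.indicator_of_mem (show e ∈ (A s)ᶜ from hcon)] using he1
  linarith

variable [MeasurableSpace S]

lemma measurable_orbit {G : S → α → S} (hG : Measurable (Function.uncurry G)) (n : ℕ) :
    Measurable fun p : S × (ℕ → α) => orbit G p.1 p.2 n := by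
  induction n with
  | zero => exact measurable_fst
  | succ n ih =>
    simp only [orbit_succ_last]
    exact hG.comp (ih.prodMk ((measurable_pi_apply n).comp measurable_snd))

lemma measurable_orbit_right {G : S → α → S} (hG : Measurable (Function.uncurry G)) (s : S)
    (n : ℕ) : Measurable fun e : ℕ → α => orbit G s e n :=
  (measurable_orbit hG n).comp measurable_prodMk_left

/-- If `W ≥ 1` off `Q` and `W` is superharmonic on `Q`, then `W` bounds the exit probability. -/
theorem iidSeq_exists_notMem_le {G : S → α → S} (hG : Measurable (Function.uncurry G))
    {Q : Set S} (hQ : MeasurableSet Q) {W : S → ℝ≥0∞} (hW1 : ∀ s ∉ Q, 1 ≤ W s)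
    (hW : ∀ s ∈ Q, ∫⁻ x, W (G s x) ∂ν ≤ W s) (s : S) :
    iidSeq ν {e | ∃ n, orbit G s e n ∉ Q} ≤ W s := by
  -- Conditioning on the first noise term reduces the horizon by one, so no stopping times are
  -- needed.
  have step : ∀ n s, iidSeq ν {e | ∃ k ≤ n, orbit G s e k ∉ Q} ≤ W s := by
    intro n
    induction n with
    | zero =>
      intro s
      by_cases hs : s ∈ Q
      · simp [hs]
      · exact prob_le_one.trans (hW1 s hs)
    | succ n ih =>
      intro s
      by_cases hs : s ∈ Q
      · have hm : MeasurableSet {e : ℕ → α | ∃ k ≤ n + 1, orbit G s e k ∉ Q} := by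
          simp only [Set.ofPred_exists, ← exists_prop]
          exact .iUnion fun k => .iUnion fun _ => measurable_orbit_right hG s k hQ.compl
        rw [iidSeq_apply ν hm]
        refine (lintegral_mono fun x => ?_).trans (hW s hs)
        refine le_trans (measure_mono ?_) (ih (G s x))
        rintro e ⟨k, hk, hek⟩
        cases k with
        | zero => exact absurd hs hek
        | succ k => exact ⟨k, by omega, hek⟩
      · exact prob_le_one.trans (hW1 s hs)
  have hU : {e : ℕ → α | ∃ n, orbit G s e n ∉ Q} = ⋃ n, {e | ∃ k ≤ n, orbit G s e k ∉ Q} := by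
    ext e
    simp only [Set.mem_ofPred_eq, Set.mem_iUnion]
    exact ⟨fun ⟨n, h⟩ => ⟨n, n, le_rfl, h⟩, fun ⟨_, k, _, h⟩ => ⟨k, h⟩⟩
  rw [hU, Monotone.measure_iUnion]
  · exact iSup_le fun n => step n s
  · intro a b hab e
    rintro ⟨k, hk, h⟩
    exact ⟨k, hk.trans hab, h⟩

end Recursion

/-! ### Gaussian sequences and innovations -/

/-- The law of a sequence of independent standard Gaussian random variables. -/
noncomputable abbrev gaussianSeq : Measure (ℕ → ℝ) := iidSeq (gaussianReal 0 1)

/-- The normalized combination `(τ g₀ + g₁) / √(1 + τ²)`. -/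
noncomputable def innovation (τ : ℝ) (g : ℕ → ℝ) : ℝ := (τ * g 0 + g 1) / √(1 + τ ^ 2)

/-- The sequence `(g₀ - τ g₁) / √(1 + τ²), g₂, g₃, …`. -/
noncomputable def residualSeq (τ : ℝ) (g : ℕ → ℝ) : ℕ → ℝ :=
  consSeq ((g 0 - τ * g 1) / √(1 + τ ^ 2)) (tailSeq (tailSeq g))

/-- After swapping the coordinates this is the rotation through the angle `arctan τ`, and the
standard Gaussian law on the plane is rotation invariant. -/
lemma measurePreserving_gaussian_rotation (τ : ℝ) :
    MeasurePreserving
      (fun p : ℝ × ℝ => ((τ * p.1 + p.2) / √(1 + τ ^ 2), (p.1 - τ * p.2) / √(1 + τ ^ 2)))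
      ((gaussianReal 0 1).prod (gaussianReal 0 1)) ((gaussianReal 0 1).prod (gaussianReal 0 1)) := by
  have hrot : MeasurePreserving (ContinuousLinearMap.rotation (E := ℝ) (Real.arctan τ))
      ((gaussianReal 0 1).prod (gaussianReal 0 1)) ((gaussianReal 0 1).prod (gaussianReal 0 1)) :=
    ⟨(ContinuousLinearMap.continuous _).measurable,
      IsGaussian.map_rotation_eq_self (by simp [integral_id_gaussianReal]) _⟩
  have hswap : MeasurePreserving (Prod.swap : ℝ × ℝ → ℝ × ℝ)
      ((gaussianReal 0 1).prod (gaussianReal 0 1)) ((gaussianReal 0 1).prod (gaussianReal 0 1)) :=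
    Measure.measurePreserving_swap
  convert! hrot.comp hswap using 1
  ext p
  · simp only [Function.comp_apply, ContinuousLinearMap.rotation_apply, Prod.fst_swap,
      Prod.snd_swap, Real.cos_arctan, Real.sin_arctan, smul_eq_mul]
    ring
  · simp only [Function.comp_apply, ContinuousLinearMap.rotation_apply, Prod.fst_swap,
      Prod.snd_swap, Real.cos_arctan, Real.sin_arctan, smul_eq_mul]
    ring

/-- Only the first two coordinates are rotated. The innovation is therefore independent of the
residual sequence, which is again i.i.d. Gaussian, so the step can be iterated. -/
lemma measurePreserving_innovation_residualSeq (τ : ℝ) :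
    MeasurePreserving (fun g => (innovation τ g, residualSeq τ g)) gaussianSeq
      ((gaussianReal 0 1).prod gaussianSeq) := by
  set γ := gaussianReal 0 1
  have h1 := measurePreserving_splitSeq γ
  have h2 := (MeasurePreserving.id γ).prod h1
  have h3 := (measurePreserving_prodAssoc γ γ (iidSeq γ)).symm
  have h4 := (measurePreserving_gaussian_rotation τ).prod (MeasurePreserving.id (iidSeq γ))
  have h5 := measurePreserving_prodAssoc γ γ (iidSeq γ)
  have h6 := (MeasurePreserving.id γ).prod (measurePreserving_consSeq γ)
  exact h6.comp (h5.comp (h4.comp (h3.comp (h2.comp h1))))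

section Innovations

variable {S : Type*}

/-- The successive innovations of a recursion whose state `s` determines the coefficient `τ s`. -/
noncomputable def innovationSeq (G : S → ℝ → S) (τ : S → ℝ) : S → (ℕ → ℝ) → ℕ → ℝ
  | s, g, 0 => innovation (τ s) g
  | s, g, n + 1 => innovationSeq G τ (G s (innovation (τ s) g)) (residualSeq (τ s) g) n

variable [MeasurableSpace S]

lemma measurable_innovation {τ : S → ℝ} (hτ : Measurable τ) :
    Measurable fun p : S × (ℕ → ℝ) => innovation (τ p.1) p.2 := by
  unfold innovation
  fun_prop

lemma measurable_residualSeq {τ : S → ℝ} (hτ : Measurable τ) :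
    Measurable fun p : S × (ℕ → ℝ) => residualSeq (τ p.1) p.2 := by
  unfold residualSeq
  refine measurable_consSeq.comp (Measurable.prodMk (by fun_prop) ?_)
  exact (measurable_tailSeq.comp measurable_tailSeq).comp measurable_snd

lemma measurable_innovationSeq {G : S → ℝ → S} (hG : Measurable (Function.uncurry G)) {τ : S → ℝ}
    (hτ : Measurable τ) :
    Measurable fun p : S × (ℕ → ℝ) => innovationSeq G τ p.1 p.2 := by
  refine measurable_pi_lambda _ fun n => ?_
  induction n with
  | zero => exact measurable_innovation hτ
  | succ n ih =>
    have h1 := measurable_innovation hτ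
    exact ih.comp ((hG.comp (measurable_fst.prodMk h1)).prodMk (measurable_residualSeq hτ))

/-- The innovations are again independent standard Gaussian random variables. -/
theorem measurePreserving_innovationSeq {G : S → ℝ → S} (hG : Measurable (Function.uncurry G))
    {τ : S → ℝ} (hτ : Measurable τ) (s : S) :
    MeasurePreserving (innovationSeq G τ s) gaussianSeq gaussianSeq := by
  have hm : ∀ s, Measurable (innovationSeq G τ s) := fun s =>
    (measurable_innovationSeq hG hτ).comp measurable_prodMk_left
  refine ⟨hm s, eq_iidSeq _ fun n t ht => ?_⟩
  rw [Measure.map_apply (hm s) (measurableSet_box n t ht)]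
  induction n generalizing s t with
  | zero => simp
  | succ n ih =>
    set γ := gaussianReal 0 1
    -- For a fixed first innovation `x`, the section of `B` is the same kind of event started from
    -- `G s x`; this is why the induction runs over all `s`.
    let B : Set (ℝ × (ℕ → ℝ)) :=
      {p | p.1 ∈ t 0 ∧ ∀ i < n, innovationSeq G τ (G s p.1) p.2 i ∈ t (i + 1)}
    have hBm : MeasurableSet B := by
      have h2 : Measurable fun p : ℝ × (ℕ → ℝ) => innovationSeq G τ (G s p.1) p.2 :=
        (measurable_innovationSeq hG hτ).comp
          ((hG.comp (measurable_prodMk_left (x := s)) |>.comp measurable_fst).prodMk measurable_snd)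
      exact (measurable_fst (ht 0)).inter (h2 (measurableSet_box n _ fun i => ht (i + 1)))
    have hpre : innovationSeq G τ s ⁻¹' {e | ∀ i < n + 1, e i ∈ t i}
        = (fun g => (innovation (τ s) g, residualSeq (τ s) g)) ⁻¹' B := by
      ext g
      refine Iff.trans ?_ (box_succ n t (innovation (τ s) g)
        (innovationSeq G τ (G s (innovation (τ s) g)) (residualSeq (τ s) g)))
      rw [Set.mem_preimage, Set.mem_ofPred_eq]
      refine forall₂_congr fun i _ => ?_
      cases i <;> rfl
    rw [hpre, (measurePreserving_innovation_residualSeq (τ s)).measure_preimage hBm.nullMeasurableSet,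
      Measure.prod_apply hBm]
    have hsec : ∀ x, gaussianSeq (Prod.mk x ⁻¹' B)
        = (t 0).indicator (fun _ => ∏ i ∈ Finset.range n, γ (t (i + 1))) x := by
      intro x
      by_cases hx : x ∈ t 0
      · rw [Set.indicator_of_mem hx, ← ih (G s x) (fun i => t (i + 1)) fun i => ht (i + 1)]
        congr 1
        ext g
        simp [B, hx]
      · have : Prod.mk x ⁻¹' B = ∅ := by ext g; simp [B, hx]
        rw [this, measure_empty, Set.indicator_of_notMem hx]
    simp_rw [hsec]
    rw [lintegral_indicator_const (ht 0), Finset.prod_range_succ']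

end Innovations

/-- The empirical second moments of a Gaussian sequence are bounded. -/
lemma ae_exists_sum_sq_le :
    ∀ᵐ e ∂gaussianSeq, ∃ C : ℝ, ∀ n : ℕ, ∑ i ∈ Finset.range n, e i ^ 2 ≤ C * n := by
  have hind : iIndepFun (fun (i : ℕ) (e : ℕ → ℝ) => e i ^ 2) gaussianSeq :=
    iIndepFun_infinitePi (X := fun _ x => x ^ 2) fun i => by fun_prop
  have hmp : ∀ i : ℕ, MeasurePreserving (fun e : ℕ → ℝ => e i) gaussianSeq (gaussianReal 0 1) :=
    fun i => measurePreserving_eval_infinitePi (fun _ : ℕ => gaussianReal 0 1) i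
  have hint : Integrable (fun e : ℕ → ℝ => e 0 ^ 2) gaussianSeq := by
    have : Integrable (fun x : ℝ => x ^ 2) (gaussianReal 0 1) :=
      (memLp_id_gaussianReal 2).integrable_sq
    exact (hmp 0).integrable_comp_of_integrable this
  have := strong_law_ae_real (μ := gaussianSeq) (fun (i : ℕ) (e : ℕ → ℝ) => e i ^ 2) hint
    (fun i j hij => hind.indepFun hij) fun i => by
      have h : IdentDistrib (fun e : ℕ → ℝ => e i) (fun e : ℕ → ℝ => e 0) gaussianSeq gaussianSeq :=
        ⟨(hmp i).measurable.aemeasurable, (hmp 0).measurable.aemeasurable,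
          (hmp i).map_eq.trans (hmp 0).map_eq.symm⟩
      exact h.comp (u := fun x => x ^ 2) (by fun_prop)
  filter_upwards [this] with e he
  obtain ⟨C, hC⟩ := he.bddAbove_range
  refine ⟨C, fun n => ?_⟩
  rcases n.eq_zero_or_pos with rfl | hn
  · simp
  · have h := hC ⟨n, rfl⟩
    rwa [div_le_iff₀ (by exact_mod_cast hn)] at h

/-- A lower bound for the Gaussian measure of a rescaled set. -/
lemma le_gaussianReal_scaled {m σ : ℝ} (hσ : 0 < σ) {B : Set ℝ} (hB : MeasurableSet B)
    (hBm : ∀ y ∈ B, |y| ≤ m * σ) :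
    gaussianPDF 0 1 m * (volume B / ENNReal.ofReal σ) ≤ gaussianReal 0 1 {e | σ * e ∈ B} := by
  have hpre : MeasurableSet {e : ℝ | σ * e ∈ B} := (measurable_const_mul σ) hB
  rw [gaussianReal_apply _ one_ne_zero]
  have hvol : volume {e : ℝ | σ * e ∈ B} = volume B / ENNReal.ofReal σ := by
    have := Real.volume_preimage_mul_left hσ.ne' B
    rw [abs_of_pos (inv_pos.2 hσ), ENNReal.ofReal_inv_of_pos hσ] at this
    rw [ENNReal.div_eq_inv_mul]
    exact this
  rw [← hvol, ← setLIntegral_const]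
  refine setLIntegral_mono_ae (by fun_prop) (Eventually.of_forall fun e he => ?_)
  have habs : |e| ≤ m := by
    have := hBm _ he
    rw [abs_mul, abs_of_pos hσ, mul_comm] at this
    exact le_of_mul_le_mul_right this hσ
  have hm : 0 ≤ m := (abs_nonneg e).trans habs
  refine ENNReal.ofReal_le_ofReal ?_
  simp only [gaussianPDFReal, sub_zero]
  refine mul_le_mul_of_nonneg_left (Real.exp_le_exp.2 ?_) (by positivity)
  have : e ^ 2 ≤ m ^ 2 := sq_le_sq' (by linarith [neg_abs_le e]) (by linarith [le_abs_self e])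
  gcongr

/-! ### The recursion of regressors and information

A state `s = (φ, r)` consists of the current regressor `φ = f(y_t)` and the information `r = 1 / P_t`
gathered before it. -/

/-- A piecewise continuous function is Borel measurable. -/
lemma PiecewiseContinuous.measurable {f : ℝ → ℝ} (hf : PiecewiseContinuous f) : Measurable f := by
  set D : Set ℝ := {x | ¬ ContinuousAt f x}
  have hD : D.Countable := by
    have : D = ⋃ n : ℕ, D ∩ Set.Icc (-(n : ℝ)) n := by
      ext x
      simp only [Set.mem_iUnion, Set.mem_inter_iff, Set.mem_Icc]
      refine ⟨fun hx => ?_, fun ⟨_, hx, _⟩ => hx⟩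
      obtain ⟨n, hn⟩ := exists_nat_ge |x|
      exact ⟨n, hx, abs_le.1 hn⟩
    rw [this]
    exact Set.countable_iUnion fun n => (hf _ _).countable
  refine measurable_of_isOpen fun U hU => ?_
  -- A continuity point of `f` in the preimage of an open set is interior to it; the other points
  -- lie in the countable set `D`.
  have : f ⁻¹' U = interior (f ⁻¹' U) ∪ (f ⁻¹' U ∩ D) := by
    ext x
    refine ⟨fun hx => ?_, fun hx => hx.elim (fun h => interior_subset h) And.left⟩
    by_cases hxD : x ∈ D
    · exact Or.inr ⟨hx, hxD⟩
    · exact Or.inl (mem_interior_iff_mem_nhds.2 ((not_not.1 hxD).preimage_mem_nhds (hU.mem_nhds hx)))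
  rw [this]
  exact isOpen_interior.measurableSet.union (hD.mono Set.inter_subset_right).measurableSet

/-- The conditional variance `1 + φ² / r` of the next output. -/
noncomputable def outputVar (s : ℝ × ℝ) : ℝ := 1 + s.1 ^ 2 / s.2

/-- The state after the output `√(outputVar s) * e`. -/
noncomputable def nextState (f : ℝ → ℝ) (s : ℝ × ℝ) (e : ℝ) : ℝ × ℝ :=
  (f (√(outputVar s) * e), s.2 + s.1 ^ 2)

/-- The noise sequences for which the conditional variances of the outputs stay bounded. -/
def boundedVar (f : ℝ → ℝ) (s : ℝ × ℝ) : Set (ℕ → ℝ) :=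
  {e | ∃ K : ℕ, ∀ n, outputVar (orbit (nextState f) s e n) ≤ K}

@[fun_prop] lemma measurable_outputVar : Measurable outputVar := by
  unfold outputVar; fun_prop

lemma measurable_nextState {f : ℝ → ℝ} (hf : Measurable f) :
    Measurable (Function.uncurry (nextState f)) := by
  unfold nextState Function.uncurry
  fun_prop

lemma one_le_outputVar {s : ℝ × ℝ} (hs : 0 < s.2) : 1 ≤ outputVar s := by
  unfold outputVar
  have : 0 ≤ s.1 ^ 2 / s.2 := by positivity
  linarith

lemma outputVar_nonneg {s : ℝ × ℝ} (hs : 0 < s.2) : 0 ≤ outputVar s :=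
  zero_le_one.trans (one_le_outputVar hs)

lemma one_le_sqrt_outputVar {s : ℝ × ℝ} (hs : 0 < s.2) : 1 ≤ √(outputVar s) :=
  Real.one_le_sqrt.2 (one_le_outputVar hs)

lemma measurableSet_boundedVar {f : ℝ → ℝ} (hf : Measurable f) (s : ℝ × ℝ) :
    MeasurableSet (boundedVar f s) := by
  unfold boundedVar
  simp only [Set.ofPred_exists, Set.ofPred_forall]
  refine .iUnion fun K => .iInter fun n => measurableSet_le ?_ measurable_const
  exact measurable_outputVar.comp (measurable_orbit_right (measurable_nextState hf) s n)

/-- The two orbits differ by the single initial variance, which does not affect boundedness. This is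
the tail property required by `ae_mem_of_forall_le_iidSeq`. -/
lemma consSeq_mem_boundedVar {f : ℝ → ℝ} (s : ℝ × ℝ) (x : ℝ) (e : ℕ → ℝ) :
    consSeq x e ∈ boundedVar f s ↔ e ∈ boundedVar f (nextState f s x) := by
  constructor
  · rintro ⟨K, hK⟩
    exact ⟨K, fun n => hK (n + 1)⟩
  · rintro ⟨K, hK⟩
    obtain ⟨K', hK'⟩ := exists_nat_ge (outputVar s)
    refine ⟨max K K', fun n => ?_⟩
    cases n with
    | zero => exact hK'.trans (by exact_mod_cast le_max_right _ _)
    | succ n => exact (hK n).trans (by exact_mod_cast le_max_left _ _)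

/-- One step of the recursion: if `boundedVar` has probability at least `p` from every state reached
by noise in `B`, it has probability at least `p * P(B)`. -/
lemma mul_le_boundedVar {f : ℝ → ℝ} (hf : Measurable f) {s : ℝ × ℝ} {B : Set ℝ}
    (hB : MeasurableSet B) {p : ℝ≥0∞}
    (hp : ∀ e ∈ B, p ≤ gaussianSeq (boundedVar f (nextState f s e))) :
    p * gaussianReal 0 1 B ≤ gaussianSeq (boundedVar f s) := by
  rw [iidSeq_apply _ (measurableSet_boundedVar hf s), ← setLIntegral_const]
  refine (setLIntegral_mono_ae' hB (Eventually.of_forall fun e he => ?_)).trans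
    (setLIntegral_le_lintegral B _)
  simpa only [consSeq_mem_boundedVar, Set.ofPred_mem_eq] using hp e he

/-- A superharmonic bound for the probability of leaving `Q`, a set of states of bounded variance. -/
lemma one_sub_le_boundedVar {f : ℝ → ℝ} (hf : Measurable f) {Q : Set (ℝ × ℝ)}
    (hQ : MeasurableSet Q) {K : ℝ} (hQK : ∀ s ∈ Q, outputVar s ≤ K) {W : ℝ × ℝ → ℝ≥0∞}
    (hW1 : ∀ s ∉ Q, 1 ≤ W s)
    (hW : ∀ s ∈ Q, ∫⁻ e, W (nextState f s e) ∂gaussianReal 0 1 ≤ W s) (s : ℝ × ℝ) :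
    1 - W s ≤ gaussianSeq (boundedVar f s) := by
  have h := iidSeq_exists_notMem_le (gaussianReal 0 1) (measurable_nextState hf) hQ hW1 hW s
  obtain ⟨N, hN⟩ := exists_nat_ge K
  have hsub : (boundedVar f s)ᶜ ⊆ {e | ∃ n, orbit (nextState f) s e n ∉ Q} := by
    intro e he
    by_contra hcon
    simp only [Set.mem_ofPred_eq, not_exists, not_not] at hcon
    exact he ⟨N, fun n => (hQK _ (hcon n)).trans hN⟩
  have h2 := (measure_mono hsub).trans h
  rw [prob_compl_eq_one_sub (measurableSet_boundedVar hf s)] at h2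
  exact tsub_le_iff_left.2 (tsub_le_iff_right.1 h2)

/-! ### States of bounded variance -/

/-- If `f` vanishes almost everywhere, the variances are almost surely bounded. -/
lemma boundedVar_eq_one_of_ae_eq_zero {f : ℝ → ℝ} (hf : Measurable f)
    (hf0 : volume {y | f y ≠ 0} = 0) {s : ℝ × ℝ} (hs : 0 < s.2) :
    1 ≤ gaussianSeq (boundedVar f s) := by
  classical
  set K : ℝ := outputVar s
  set Q : Set (ℝ × ℝ) := {s | 0 < s.2 ∧ outputVar s ≤ K}
  have hQ : MeasurableSet Q := (measurableSet_lt measurable_const measurable_snd).inter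
    (measurableSet_le measurable_outputVar measurable_const)
  have hsQ : s ∈ Q := ⟨hs, le_rfl⟩
  -- With the indicator of `Qᶜ` as superharmonic function, it suffices that one step almost surely
  -- stays in `Q`: the next regressor is `0`, so the next variance is `1`.
  have h := one_sub_le_boundedVar hf hQ (K := K) (fun s hs => hs.2)
    (W := Qᶜ.indicator fun _ => 1) (fun s hs => by simp [hs]) (fun s hs => ?_) s
  · simpa [hsQ] using h
  · have hσ : 0 < √(outputVar s) := one_pos.trans_le (one_le_sqrt_outputVar hs.1)
    have h0 : ∀ᵐ e ∂gaussianReal 0 1, f (√(outputVar s) * e) = 0 := by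
      refine (gaussianReal_absolutelyContinuous 0 one_ne_zero) ?_
      have := Real.volume_preimage_mul_left hσ.ne' {y | f y ≠ 0}
      rw [hf0, mul_zero] at this
      exact this
    rw [lintegral_congr_ae (g := fun _ => 0)]
    · simp
    · filter_upwards [h0] with e he
      have hR : 0 < s.2 + s.1 ^ 2 := by have := hs.1; positivity
      have hq : nextState f s e ∈ Q :=
        ⟨hR, by
          have : outputVar (nextState f s e) = 1 := by
            change 1 + f (√(outputVar s) * e) ^ 2 / _ = 1
            simp [he]
          exact this.le.trans ((one_le_outputVar hs.1).trans hs.2)⟩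
      simp [hq]

/-- Exponential moments control the tails of the regressor polynomially. -/
lemma exists_tail_bound {f : ℝ → ℝ} {k₁ k₂ : ℝ} (hk₂ : 0 < k₂)
    (hfk : ∀ x, |f x| ≤ k₁ * Real.exp (k₂ * |x|)) {K : ℝ} (hK : 2 ≤ K) :
    ∃ C : ℝ, 0 < C ∧ ∀ s : ℝ × ℝ, 0 < s.2 → outputVar s ≤ K → ∀ R : ℝ, 0 < R →
      (gaussianReal 0 1).real {e | (K - 1) * R < f (√(outputVar s) * e) ^ 2} ≤ C / R ^ 3 := by
  -- Markov's inequality for the sixth moment of `f` yields `R⁻³`, which is beaten by the `R⁻²` gain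
  -- in `trap_inequality`.
  set a : ℝ := 6 * (k₂ * √K)
  set F : ℝ → ℝ := fun e => k₁ ^ 6 * Real.exp (a * |e|)
  have hF0 : ∀ e, 0 ≤ F e := fun e => by positivity
  have hFi : Integrable F (gaussianReal 0 1) := by
    refine Integrable.const_mul ?_ _
    refine ((integrable_exp_mul_gaussianReal a).add (integrable_exp_mul_gaussianReal (-a))).mono'
      (by fun_prop) (Eventually.of_forall fun e => ?_)
    rw [Real.norm_of_nonneg (Real.exp_pos _).le]
    simp only [Pi.add_apply]
    rcases abs_cases e with ⟨h, _⟩ | ⟨h, _⟩ <;> rw [h]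
    · have := Real.exp_pos (-a * e); linarith
    · have := Real.exp_pos (a * e)
      rw [show a * -e = -a * e by ring]; linarith
  have hI : 0 ≤ ∫ e, F e ∂gaussianReal 0 1 := integral_nonneg hF0
  refine ⟨(∫ e, F e ∂gaussianReal 0 1) + 1, by linarith, fun s hs hsK R hR => ?_⟩
  have hsub : {e | (K - 1) * R < f (√(outputVar s) * e) ^ 2} ⊆ {e | R ^ 3 ≤ F e} := by
    intro e he
    have h1 : R ≤ f (√(outputVar s) * e) ^ 2 := by
      have : (K - 1) * R < f (√(outputVar s) * e) ^ 2 := he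
      nlinarith
    have h2 : |f (√(outputVar s) * e)| ≤ k₁ * Real.exp (k₂ * √K * |e|) := by
      refine (hfk _).trans ?_
      have hk₁ : 0 ≤ k₁ := by simpa using (abs_nonneg _).trans (hfk 0)
      refine mul_le_mul_of_nonneg_left (Real.exp_le_exp.2 ?_) hk₁
      rw [abs_mul, abs_of_nonneg (Real.sqrt_nonneg _), mul_assoc]
      have := Real.sqrt_le_sqrt hsK
      gcongr
    have h3 : R ^ 3 ≤ (f (√(outputVar s) * e) ^ 2) ^ 3 := by gcongr
    refine h3.trans ?_
    rw [← sq_abs, ← pow_mul]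
    calc |f (√(outputVar s) * e)| ^ (2 * 3) ≤ (k₁ * Real.exp (k₂ * √K * |e|)) ^ (2 * 3) := by gcongr
      _ = F e := by
        simp only [F, a, mul_pow, ← Real.exp_nat_mul]
        norm_num
        ring_nf
        simp
  have h := mul_meas_ge_le_integral_of_nonneg (Eventually.of_forall hF0) hFi (R ^ 3)
  have h' := measureReal_mono (μ := gaussianReal 0 1) hsub
  rw [le_div_iff₀ (by positivity)]
  have : 0 < R ^ 3 := by positivity
  nlinarith

/-- Superharmonicity of `1 / R`: `y` is the exit probability, paid at the value `1`, and `x` the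
probability of gaining `δ`. The gain is at least `c δ / (2 R²)`, and the lower bound on `R` makes `C
/ R³` no larger. -/
lemma trap_inequality {C c δ R x y : ℝ} (hc : 0 < c) (hδ : 0 < δ)
    (hR : δ ≤ R) (hR' : 2 * C / (c * δ) ≤ R) (hx : c ≤ x) (hy : y ≤ C / R ^ 3) :
    y + (1 / R * (1 - x) + 1 / (R + δ) * x) ≤ 1 / R := by
  have hR0 : 0 < R := hδ.trans_le hR
  have h1 : C / R ^ 3 ≤ c * δ / (2 * R ^ 2) := by
    rw [div_le_iff₀ (by positivity)] at hR'
    rw [div_le_div_iff₀ (by positivity) (by positivity)]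
    nlinarith [pow_pos hR0 2]
  have h2 : c * δ / (2 * R ^ 2) ≤ x * (1 / R - 1 / (R + δ)) := by
    have : 1 / R - 1 / (R + δ) = δ / (R * (R + δ)) := by
      field_simp
      ring
    rw [this, mul_div_assoc', div_le_div_iff₀ (by positivity) (by positivity)]
    have hRR : R * (R + δ) ≤ 2 * R ^ 2 := by nlinarith
    have hx0 : 0 < x := hc.trans_le hx
    exact mul_le_mul (by gcongr) hRR (by positivity) (by positivity)
  linarith

/-- From states with enough information and bounded variance, the variances stay bounded with
probability at least one half. -/
lemma exists_half_le_boundedVar {f : ℝ → ℝ} (hf : Measurable f) {k₁ k₂ : ℝ} (hk₂ : 0 < k₂)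
    (hfk : ∀ x, |f x| ≤ k₁ * Real.exp (k₂ * |x|)) {K : ℝ} (hK : 2 ≤ K) {δ c : ℝ} (hδ : 0 < δ)
    (hc : 0 < c) (hG : ∀ s : ℝ × ℝ, 0 < s.2 → outputVar s ≤ K →
      c ≤ (gaussianReal 0 1).real {e | δ ≤ f (√(outputVar s) * e) ^ 2}) :
    ∃ r₀ : ℝ, ∀ s : ℝ × ℝ, 0 < s.2 → outputVar s ≤ K → r₀ ≤ s.2 + s.1 ^ 2 →
      1 / 2 ≤ gaussianSeq (boundedVar f s) := by
  classical
  obtain ⟨C, hC, htail⟩ := exists_tail_bound hk₂ hfk hK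
  -- The first two entries are the hypotheses of `trap_inequality`; the entry `2` makes `W ≤ 1 / 2`
  -- on `Q`.
  set r₀ : ℝ := max (max δ (2 * C / (c * δ))) 2
  have hr1 : δ ≤ r₀ := (le_max_left _ _).trans (le_max_left _ _)
  have hr2 : 2 * C / (c * δ) ≤ r₀ := (le_max_right _ _).trans (le_max_left _ _)
  have hr3 : 2 ≤ r₀ := le_max_right _ _
  set Q : Set (ℝ × ℝ) := {s | 0 < s.2 ∧ outputVar s ≤ K ∧ r₀ ≤ s.2 + s.1 ^ 2}
  have hQ : MeasurableSet Q := (measurableSet_lt measurable_const measurable_snd).inter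
    ((measurableSet_le measurable_outputVar measurable_const).inter
      (measurableSet_le measurable_const
        (measurable_snd.add (measurable_fst.pow_const 2))))
  set W : ℝ × ℝ → ℝ≥0∞ := fun s => if s ∈ Q then ENNReal.ofReal (1 / (s.2 + s.1 ^ 2)) else 1
  refine ⟨r₀, fun s hs hsK hsr => ?_⟩
  have h := one_sub_le_boundedVar hf hQ (K := K) (fun s hs => hs.2.1) (W := W)
    (fun s hs => by simp [W, hs]) (fun s hs => ?_) s
  · refine le_trans ?_ h
    have hsQ : s ∈ Q := ⟨hs, hsK, hsr⟩
    have : W s ≤ 1 / 2 := by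
      simp only [W, if_pos hsQ]
      rw [ENNReal.ofReal_le_iff_le_toReal (by simp)]
      simp only [one_div, ENNReal.toReal_inv, ENNReal.toReal_ofNat]
      exact inv_anti₀ two_pos (hr3.trans hsr)
    refine le_trans ?_ (tsub_le_tsub_left this 1)
    simp
  · obtain ⟨hs, hsK, hsr⟩ := hs
    set R := s.2 + s.1 ^ 2
    have hR : 0 < R := two_pos.trans_le (hr3.trans hsr)
    set σ := √(outputVar s)
    set T : Set ℝ := {e | (K - 1) * R < f (σ * e) ^ 2}
    set B : Set ℝ := {e | δ ≤ f (σ * e) ^ 2}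
    have hTm : MeasurableSet T := measurableSet_lt measurable_const (by fun_prop)
    have hBm : MeasurableSet B := measurableSet_le measurable_const (by fun_prop)
    -- Off `T` the next state stays in `Q`. There the information never decreases, and on `B` it
    -- grows by at least `δ`.
    have hpt : ∀ e, W (nextState f s e) ≤ T.indicator (fun _ => 1) e +
        (Bᶜ.indicator (fun _ => ENNReal.ofReal (1 / R)) e +
          B.indicator (fun _ => ENNReal.ofReal (1 / (R + δ))) e) := by
      intro e
      by_cases heT : e ∈ T
      · rw [Set.indicator_of_mem heT]
        refine le_trans ?_ le_self_add
        by_cases hq : nextState f s e ∈ Q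
        · simp only [W, if_pos hq]
          rw [ENNReal.ofReal_le_one, div_le_one (by linarith [hq.2.2])]
          linarith [hq.2.2]
        · simp [W, hq]
      · have heT' : f (σ * e) ^ 2 ≤ (K - 1) * R := not_lt.1 heT
        have hq : nextState f s e ∈ Q := by
          refine ⟨hR, ?_, ?_⟩
          · change 1 + f (σ * e) ^ 2 / R ≤ K
            have := (div_le_iff₀ hR).2 heT'
            linarith
          · change r₀ ≤ R + f (σ * e) ^ 2
            nlinarith
        refine le_trans ?_ le_add_self
        simp only [W, if_pos hq]
        change ENNReal.ofReal (1 / (R + f (σ * e) ^ 2)) ≤ _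
        by_cases heB : e ∈ B
        · rw [Set.indicator_of_mem heB]
          refine le_trans (ENNReal.ofReal_le_ofReal ?_) le_add_self
          have : δ ≤ f (σ * e) ^ 2 := heB
          gcongr
        · rw [Set.indicator_of_mem (show e ∈ Bᶜ from heB)]
          refine le_trans (ENNReal.ofReal_le_ofReal ?_) le_self_add
          refine one_div_le_one_div_of_le hR ?_
          nlinarith
    have hWs : W s = ENNReal.ofReal (1 / R) := if_pos ⟨hs, hsK, hsr⟩
    rw [hWs]
    refine (lintegral_mono hpt).trans ?_
    rw [lintegral_add_left (measurable_const.indicator hTm),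
      lintegral_add_left (measurable_const.indicator hBm.compl), lintegral_indicator_const hTm,
      lintegral_indicator_const hBm.compl, lintegral_indicator_const hBm, one_mul,
      ← ofReal_measureReal (s := T), ← ofReal_measureReal (s := B), ← ofReal_measureReal (s := Bᶜ),
      ← ENNReal.ofReal_mul (by positivity), ← ENNReal.ofReal_mul (by positivity),
      ← ENNReal.ofReal_add (by positivity) (by positivity),
      ← ENNReal.ofReal_add (by positivity) (by positivity), probReal_compl_eq_one_sub hBm]
    refine ENNReal.ofReal_le_ofReal ?_
    exact trap_inequality hc hδ (hr1.trans hsr) (hr2.trans hsr) (hG s hs hsK)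
      (htail s hs hsK R hR)

/-- A function that does not vanish almost everywhere is bounded away from zero on a bounded set of
positive measure. -/
lemma exists_volume_pos_of_not_ae_eq_zero {f : ℝ → ℝ} (hf0 : volume {y | f y ≠ 0} ≠ 0) :
    ∃ M δ : ℝ, 0 < δ ∧ 0 < volume {y | |y| ≤ M ∧ δ ≤ f y ^ 2} := by
  have hU : {y | f y ≠ 0} ⊆ ⋃ n : ℕ, {y | |y| ≤ n ∧ 1 / ((n : ℝ) + 1) ≤ f y ^ 2} := by
    intro y hy
    obtain ⟨n, hn⟩ := exists_nat_ge |y|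
    obtain ⟨m, hm⟩ := exists_nat_one_div_lt (show 0 < f y ^ 2 from pow_pos (abs_pos.2 hy) 2 |>.trans_eq
      (sq_abs _))
    refine Set.mem_iUnion.2 ⟨max n m, hn.trans (by exact_mod_cast le_max_left n m), le_trans ?_ hm.le⟩
    refine one_div_le_one_div_of_le (by positivity) ?_
    have : (m : ℝ) ≤ (max n m : ℕ) := by exact_mod_cast le_max_right n m
    linarith
  obtain ⟨n, hn⟩ := exists_measure_pos_of_not_measure_iUnion_null
    (fun h => hf0 (measure_mono_null hU h))
  exact ⟨n, 1 / ((n : ℝ) + 1), by positivity, hn⟩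

/-- From states of bounded variance, `boundedVar` has a probability bounded away from zero. -/
lemma exists_le_boundedVar_of_outputVar_le {f : ℝ → ℝ} (hf : Measurable f) {k₁ k₂ : ℝ} (hk₂ : 0 < k₂)
    (hfk : ∀ x, |f x| ≤ k₁ * Real.exp (k₂ * |x|)) {r : ℝ} (hr : 0 < r) :
    ∃ K₀ : ℝ, ∀ K, K₀ ≤ K → ∃ p : ℝ≥0∞, 0 < p ∧ ∀ s : ℝ × ℝ, r ≤ s.2 → outputVar s ≤ K →
      p ≤ gaussianSeq (boundedVar f s) := by
  by_cases hf0 : volume {y | f y ≠ 0} = 0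
  · exact ⟨0, fun K _ => ⟨1, one_pos, fun s hs _ =>
      boundedVar_eq_one_of_ae_eq_zero hf hf0 (hr.trans_le hs)⟩⟩
  obtain ⟨M, δ, hδ, hvol⟩ := exists_volume_pos_of_not_ae_eq_zero hf0
  set E : Set ℝ := {y | |y| ≤ M ∧ δ ≤ f y ^ 2}
  have hE : MeasurableSet E := by
    have h1 : MeasurableSet {y : ℝ | |y| ≤ M} := measurableSet_le (by fun_prop) measurable_const
    have h2 : MeasurableSet {y : ℝ | δ ≤ f y ^ 2} := measurableSet_le measurable_const (by fun_prop)
    exact h1.inter h2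
  obtain ⟨y₀, hy₀⟩ := nonempty_of_measure_ne_zero hvol.ne'
  have hM : 0 ≤ M := (abs_nonneg y₀).trans hy₀.1
  have hk₁ : 0 ≤ k₁ := by simpa using (abs_nonneg _).trans (hfk 0)
  set b : ℝ := k₁ * Real.exp (k₂ * M)
  have hEb : ∀ y ∈ E, f y ^ 2 ≤ b ^ 2 := fun y hy => by
    rw [← sq_abs]
    have : |f y| ≤ b := (hfk y).trans
      (mul_le_mul_of_nonneg_left (Real.exp_le_exp.2 (mul_le_mul_of_nonneg_left hy.1 hk₂.le)) hk₁)
    gcongr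
  -- Here `b` bounds `|f|` on `E`. Since the information is at least `r`, an output in `E` leaves
  -- the next variance below `1 + b² / r ≤ K`.
  refine ⟨max 2 (1 + b ^ 2 / r), fun K hK => ?_⟩
  have hK2 : 2 ≤ K := (le_max_left _ _).trans hK
  have hKb : 1 + b ^ 2 / r ≤ K := (le_max_right _ _).trans hK
  set c : ℝ≥0∞ := gaussianPDF 0 1 M * (volume E / ENNReal.ofReal √K)
  have hc : 0 < c := by
    refine ENNReal.mul_pos (gaussianPDF_pos _ one_ne_zero _).ne' ?_
    exact (ENNReal.div_pos hvol.ne' ENNReal.ofReal_ne_top).ne'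
  have hcE : ∀ s : ℝ × ℝ, 0 < s.2 → outputVar s ≤ K →
      c ≤ gaussianReal 0 1 {e | √(outputVar s) * e ∈ E} := by
    intro s hs hsK
    have h1 := one_le_sqrt_outputVar hs
    refine le_trans ?_ (le_gaussianReal_scaled (m := M) (one_pos.trans_le h1) hE
      fun y hy => hy.1.trans (le_mul_of_one_le_right hM h1))
    refine mul_le_mul_right (ENNReal.div_le_div_left ?_ _) _
    exact ENNReal.ofReal_le_ofReal (Real.sqrt_le_sqrt hsK)
  have hc1 : c ≤ 1 := by
    refine (hcE (0, 1) one_pos ?_).trans prob_le_one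
    simp only [outputVar]; norm_num; linarith
  have hctop : c ≠ ∞ := (hc1.trans_lt ENNReal.one_lt_top).ne
  obtain ⟨r₀, hr₀⟩ := exists_half_le_boundedVar hf hk₂ hfk hK2 hδ
    (ENNReal.toReal_pos hc.ne' hctop) fun s hs hsK => by
      refine ENNReal.toReal_mono (measure_ne_top _ _) ((hcE s hs hsK).trans (measure_mono ?_))
      exact fun e he => he.2
  -- `n` counts the visits to `E` still allowed: each has probability at least `c`, keeps the
  -- variance below `K` and adds `δ` to the information.
  have hind : ∀ n : ℕ, ∀ s : ℝ × ℝ, r ≤ s.2 → outputVar s ≤ K → r₀ ≤ s.2 + s.1 ^ 2 + n * δ →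
      1 / 2 * c ^ n ≤ gaussianSeq (boundedVar f s) := by
    intro n
    induction n with
    | zero =>
      intro s hs hsK hsr
      simpa using hr₀ s (hr.trans_le hs) hsK (by simpa using hsr)
    | succ n ih =>
      intro s hs hsK hsr
      have hs0 := hr.trans_le hs
      have hB : MeasurableSet {e : ℝ | √(outputVar s) * e ∈ E} := (measurable_const_mul _) hE
      refine le_trans ?_ (mul_le_boundedVar hf hB (p := 1 / 2 * c ^ n) fun e he => ?_)
      · rw [pow_succ, ← mul_assoc]
        exact mul_le_mul_right (hcE s hs0 hsK) _
      · have hfe : δ ≤ f (√(outputVar s) * e) ^ 2 := he.2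
        have hR : r ≤ s.2 + s.1 ^ 2 := hs.trans (le_add_of_nonneg_right (sq_nonneg _))
        refine ih _ hR ?_ ?_
        · change 1 + f (√(outputVar s) * e) ^ 2 / (s.2 + s.1 ^ 2) ≤ K
          refine le_trans ?_ hKb
          have := hEb _ he
          gcongr
        · change r₀ ≤ s.2 + s.1 ^ 2 + f (√(outputVar s) * e) ^ 2 + n * δ
          push_cast at hsr
          linarith
  obtain ⟨n, hn⟩ := exists_nat_ge (r₀ / δ)
  refine ⟨1 / 2 * c ^ n, ENNReal.mul_pos (by simp) (pow_ne_zero _ hc.ne'), fun s hs hsK =>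
    hind n s hs hsK ?_⟩
  have := (div_le_iff₀ hδ).1 hn
  have h0 := hr.trans_le hs
  nlinarith [sq_nonneg s.1]

/-! ### States of large variance -/

/-- While the variance is large, the growth condition holds for the next regressor with a probability
bounded away from zero. -/
lemma exists_le_gaussianReal_growth {f : ℝ → ℝ} (hf : Measurable f) {k₁ k₂ : ℝ} (hk₂ : 0 < k₂)
    (hfk : ∀ x, |f x| ≤ k₁ * Real.exp (k₂ * |x|)) {b L : ℝ} (hL : 0 < L)
    (hliminf : 0 < liminf
      (fun l : ℝ => volume (growthSet f b L ∩ Set.Icc (-l) l) / ENNReal.ofReal l) atTop)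
    {b' : ℝ} (hb' : 0 ≤ b') (hbb' : b ≤ b') :
    ∃ C K₀ : ℝ, 0 < C ∧ ∃ c : ℝ≥0∞, 0 < c ∧ ∀ s : ℝ × ℝ, 0 < s.2 → K₀ ≤ outputVar s →
      c ≤ gaussianReal 0 1 {e | f (√(outputVar s) * e) ^ 2 ≤ C * outputVar s ^ b'} := by
  obtain ⟨c, hc0, hc⟩ := exists_between hliminf
  obtain ⟨l₀, hl₀⟩ := eventually_atTop.1 (eventually_lt_of_lt_liminf hc)
  have hk₁ : 0 ≤ k₁ := by simpa using (abs_nonneg _).trans (hfk 0)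
  -- `L` serves for `|y| ≥ 1`, where raising the exponent to `b'` is harmless. For `|y| ≤ 1`, where
  -- `|y| ^ b` may be large, the exponential bound takes over.
  set A : ℝ := max L (k₁ * Real.exp k₂)
  have hA : 0 < A := hL.trans_le (le_max_left _ _)
  have hm : MeasurableSet (growthSet f b L) := measurableSet_lt (by fun_prop) (by fun_prop)
  refine ⟨A ^ 2, l₀ ^ 2, by positivity, gaussianPDF 0 1 1 * c,
    ENNReal.mul_pos (gaussianPDF_pos _ one_ne_zero _).ne' hc0.ne', fun s hs hsK => ?_⟩
  set σ := √(outputVar s)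
  have hσ : 1 ≤ σ := one_le_sqrt_outputVar hs
  have hσ0 : 0 < σ := one_pos.trans_le hσ
  have hl : l₀ ≤ σ := (le_abs_self _).trans (Real.abs_le_sqrt hsK)
  refine (mul_le_mul_right (hl₀ σ hl).le _).trans ((le_gaussianReal_scaled (m := 1) hσ0
    (hm.inter measurableSet_Icc) fun y hy => ?_).trans (measure_mono fun e he => ?_))
  · rw [one_mul]; exact abs_le.2 hy.2
  · obtain ⟨hg, hI⟩ := he
    set y := σ * e
    have hy : |y| ≤ σ := abs_le.2 hI
    have h1 : |f y| ≤ A * σ ^ b' := by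
      rcases le_total 1 |y| with h | h
      · have hg' : |f y| < L * |y| ^ b := hg
        refine hg'.le.trans (mul_le_mul (le_max_left _ _) ?_ (by positivity) hA.le)
        exact (Real.rpow_le_rpow_of_exponent_le h hbb').trans
          (Real.rpow_le_rpow (abs_nonneg _) hy hb')
      · have h2 : |f y| ≤ A := by
          refine (hfk y).trans (le_trans ?_ (le_max_right _ _))
          refine mul_le_mul_of_nonneg_left (Real.exp_le_exp.2 ?_) hk₁
          nlinarith
        refine h2.trans (le_mul_of_one_le_right hA.le (Real.one_le_rpow hσ hb'))
    have h3 : outputVar s ^ b' = (σ ^ b') ^ 2 := by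
      rw [← Real.rpow_mul_natCast hσ0.le, mul_comm, Real.rpow_natCast_mul hσ0.le]
      rw [Real.sq_sqrt (outputVar_nonneg hs)]
    change f y ^ 2 ≤ _
    rw [h3, ← mul_pow, ← sq_abs]
    gcongr

/-- The logarithm of the information, normalized to be at least `1`. -/
noncomputable def logInfo (r x : ℝ) : ℝ := 1 + Real.log (x / r)

lemma one_le_logInfo {r x : ℝ} (hr : 0 < r) (hx : r ≤ x) : 1 ≤ logInfo r x := by
  have : 0 ≤ Real.log (x / r) := Real.log_nonneg ((one_le_div hr).2 hx)
  unfold logInfo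
  linarith

/-- For growth exponents below `4` the logarithm of the information cannot explode: this is where
`λ² - b λ + b` having no real root enters. -/
lemma exists_logInfo_contraction {b C r : ℝ} (hb0 : 0 < b) (hb : b < 4) (hC : 0 < C) (hr : 0 < r) :
    ∃ κ K₀ : ℝ, 0 < κ ∧ ∀ (s : ℝ × ℝ) (φ : ℝ), r ≤ s.2 → K₀ ≤ outputVar s →
      φ ^ 2 ≤ C * outputVar s ^ b → K₀ ≤ outputVar (φ, s.2 + s.1 ^ 2) →
      logInfo r (s.2 + s.1 ^ 2 + φ ^ 2) ≤ (b + κ) * logInfo r (s.2 + s.1 ^ 2) ∧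
      ∀ m : ℝ, 0 < m → logInfo r (s.2 + s.1 ^ 2) ≤ m * logInfo r s.2 →
        logInfo r (s.2 + s.1 ^ 2 + φ ^ 2) ≤ (m - κ) * logInfo r (s.2 + s.1 ^ 2) := by
  have hsb : √b * √b = b := Real.mul_self_sqrt hb0.le
  have hsb0 : 0 < √b := Real.sqrt_pos.2 hb0
  have hsb2 : √b < 2 := by
    rw [Real.sqrt_lt' two_pos]; linarith
  set κ : ℝ := √b - b / 2 with hκdef
  have hκ : 0 < κ := by nlinarith
  set c : ℝ := 1 - Real.log r + Real.log (2 * C)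
  -- The entry `2` gives `R ≤ φ²`, so the new information is at most `2 φ²`; the other absorbs the
  -- constant `c` into `κ * logInfo r R`.
  refine ⟨κ, max 2 (Real.exp (c / κ)), hκ, fun s φ hs hK hφ hK' => ?_⟩
  have hs0 : 0 < s.2 := hr.trans_le hs
  set R := s.2 + s.1 ^ 2
  have hR0 : 0 < R := by positivity
  have hρ : outputVar s = R / s.2 := by
    simp only [outputVar, R]; field_simp
  have hρ0 : 0 < outputVar s := by rw [hρ]; positivity
  have hz : 1 ≤ logInfo r s.2 := one_le_logInfo hr hs
  have hlogρ : Real.log (outputVar s) = logInfo r R - logInfo r s.2 := by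
    rw [hρ, logInfo, logInfo, Real.log_div hR0.ne' hs0.ne', Real.log_div hR0.ne' hr.ne',
      Real.log_div hs0.ne' hr.ne']
    ring
  have hζ : c ≤ κ * logInfo r R := by
    have : c / κ ≤ Real.log (outputVar s) :=
      (Real.le_log_iff_exp_le hρ0).2 ((le_max_right _ _).trans hK)
    rw [div_le_iff₀ hκ] at this
    nlinarith
  have hφR : R ≤ φ ^ 2 := by
    have : 2 ≤ 1 + φ ^ 2 / R := (le_max_left _ _).trans hK'
    have h1 : 1 ≤ φ ^ 2 / R := by linarith
    exact (one_le_div hR0).1 h1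
  have hmain : logInfo r (R + φ ^ 2) ≤ c + b * (logInfo r R - logInfo r s.2) := by
    have h1 : R + φ ^ 2 ≤ 2 * C * outputVar s ^ b := by linarith
    have h2 : Real.log (R + φ ^ 2) ≤ Real.log (2 * C) + b * Real.log (outputVar s) := by
      rw [← Real.log_rpow hρ0, ← Real.log_mul (by positivity) (by positivity)]
      exact Real.log_le_log (by positivity) h1
    rw [logInfo, Real.log_div (by positivity) hr.ne', ← hlogρ]
    linarith
  refine ⟨by nlinarith, fun m hm hle => ?_⟩
  -- This is `m + b / m ≥ 2√b`, cleared of the denominator. As `2√b = b + 2κ`, one `κ` pays for the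
  -- constant and the other is the decrease of the ratio.
  have h3 : m * ((2 * √b - m) * logInfo r R) ≤ m * (b * logInfo r s.2) := by
    have h4 : (2 * √b - m) * m ≤ b := by nlinarith [sq_nonneg (m - √b)]
    have h5 : 0 ≤ logInfo r R := zero_le_one.trans
      (one_le_logInfo hr (hs.trans (le_add_of_nonneg_right (sq_nonneg _))))
    nlinarith
  have h6 := le_of_mul_le_mul_left h3 hm
  have h7 : (b + 2 * κ - m) * logInfo r R ≤ b * logInfo r s.2 := by
    rwa [show b + 2 * κ - m = 2 * √b - m by rw [hκdef]; ring]
  nlinarith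

/-- The conditional variances of the outputs are almost surely bounded, from every state. -/
theorem ae_mem_boundedVar {f : ℝ → ℝ} (hf : Measurable f) {k₁ k₂ : ℝ} (hk₂ : 0 < k₂)
    (hfk : ∀ x, |f x| ≤ k₁ * Real.exp (k₂ * |x|)) {b L : ℝ} (hb : b < 4) (hL : 0 < L)
    (hliminf : 0 < liminf
      (fun l : ℝ => volume (growthSet f b L ∩ Set.Icc (-l) l) / ENNReal.ofReal l) atTop)
    (s : ℝ × ℝ) (hs : 0 < s.2) : ∀ᵐ e ∂gaussianSeq, e ∈ boundedVar f s := by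
  set r := s.2
  -- The contraction needs a positive exponent; raising `b` to at least `1` keeps it below `4`.
  set b' := max b 1
  have hb'0 : 0 < b' := one_pos.trans_le (le_max_right _ _)
  have hb'4 : b' < 4 := max_lt hb (by norm_num)
  obtain ⟨C, K₁, hC, c, hc, hgrowth⟩ := exists_le_gaussianReal_growth hf hk₂ hfk hL hliminf
    hb'0.le (le_max_left b 1)
  obtain ⟨κ, K₂, hκ, hcontr⟩ := exists_logInfo_contraction hb'0 hb'4 hC hs
  obtain ⟨K₃, hK₃⟩ := exists_le_boundedVar_of_outputVar_le hf hk₂ hfk hs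
  set K := max (max K₁ K₂) K₃
  have hK1 : K₁ ≤ K := (le_max_left _ _).trans (le_max_left _ _)
  have hK2 : K₂ ≤ K := (le_max_right _ _).trans (le_max_left _ _)
  obtain ⟨p₀, hp₀, hbase⟩ := hK₃ K (le_max_right _ _)
  have hmono : ∀ t : ℝ × ℝ, r ≤ t.2 → r ≤ t.2 + t.1 ^ 2 := fun t ht =>
    ht.trans (le_add_of_nonneg_right (sq_nonneg _))
  -- After a favourable step the variance is either still large, where `p` applies, or at most `K`,
  -- where `p₀` does.
  have hstep : ∀ (t : ℝ × ℝ) (p : ℝ≥0∞), r ≤ t.2 → K ≤ outputVar t →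
      (∀ φ : ℝ, φ ^ 2 ≤ C * outputVar t ^ b' → K ≤ outputVar (φ, t.2 + t.1 ^ 2) →
        p ≤ gaussianSeq (boundedVar f (φ, t.2 + t.1 ^ 2))) →
      min p p₀ * c ≤ gaussianSeq (boundedVar f t) := by
    intro t p ht htK h
    refine le_trans (mul_le_mul_right (hgrowth t (hs.trans_le ht) (hK1.trans htK)) _)
      (mul_le_boundedVar hf (measurableSet_le (by fun_prop) measurable_const) fun e he => ?_)
    rcases le_total K (outputVar (nextState f t e)) with h' | h'
    · exact (min_le_left _ _).trans (h _ he h')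
    · exact (min_le_right _ _).trans (hbase _ (hmono t ht) h')
  -- Each favourable step that leaves the variance large lowers the bound `n * κ` on the ratio by
  -- `κ`. At `n = 0` no state is left, because `logInfo` is at least `1`.
  have hind : ∀ n : ℕ, ∃ p : ℝ≥0∞, 0 < p ∧ ∀ t : ℝ × ℝ, r ≤ t.2 →
      logInfo r (t.2 + t.1 ^ 2) ≤ n * κ * logInfo r t.2 → p ≤ gaussianSeq (boundedVar f t) := by
    intro n
    induction n with
    | zero =>
      refine ⟨1, one_pos, fun t ht h => ?_⟩
      have := one_le_logInfo hs (hmono t ht)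
      simp only [Nat.cast_zero, zero_mul] at h
      linarith
    | succ n ih =>
      obtain ⟨p, hp, hpn⟩ := ih
      refine ⟨min p₀ (min p p₀ * c), lt_min hp₀ (ENNReal.mul_pos (lt_min hp hp₀).ne' hc.ne'),
        fun t ht h => ?_⟩
      rcases le_total K (outputVar t) with htK | htK
      · refine (min_le_right _ _).trans (hstep t p ht htK fun φ hφ hφK => hpn _ (hmono t ht) ?_)
        have := (hcontr t φ ht (hK2.trans htK) hφ (hK2.trans hφK)).2 _ (by positivity) h
        refine this.trans_eq ?_
        push_cast
        ring
      · exact (min_le_left _ _).trans (hbase t ht htK)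
  -- The initial ratio is arbitrary, but one favourable step brings it below `b' + κ`, which fixes
  -- `n` uniformly.
  obtain ⟨n, hn⟩ := exists_nat_ge ((b' + κ) / κ)
  have hn' : b' + κ ≤ n * κ := (div_le_iff₀ hκ).1 hn
  obtain ⟨p, hp, hpn⟩ := hind n
  refine ae_mem_of_forall_le_iidSeq (gaussianReal 0 1) (G := nextState f) (D := {t | r ≤ t.2})
    (A := boundedVar f) (fun t ht x => hmono t ht) (fun t _ => measurableSet_boundedVar hf t)
    consSeq_mem_boundedVar (p := min p₀ (min p p₀ * c))
    (lt_min hp₀ (ENNReal.mul_pos (lt_min hp hp₀).ne' hc.ne')) (fun t ht => ?_) s (le_refl r)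
  rcases le_total K (outputVar t) with htK | htK
  · refine (min_le_right _ _).trans (hstep t p ht htK fun φ hφ hφK => hpn _ (hmono t ht) ?_)
    refine (hcontr t φ ht (hK2.trans htK) hφ (hK2.trans hφK)).1.trans ?_
    have := one_le_logInfo hs (hmono t ht)
    change (b' + κ) * logInfo r (t.2 + t.1 ^ 2) ≤ n * κ * logInfo r (t.2 + t.1 ^ 2)
    gcongr
  · exact (min_le_left _ _).trans (hbase t ht htK)

/-! ### Innovations of the least-squares algorithm -/

section FilterStep

variable {S : Type*}

/-- One step of a recursion together with the passage to the residual noise. -/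
noncomputable def filterStep (G : S → ℝ → S) (τ : S → ℝ) (p : S × (ℕ → ℝ)) : S × (ℕ → ℝ) :=
  (G p.1 (innovation (τ p.1) p.2), residualSeq (τ p.1) p.2)

/-- The definition of `innovationSeq` unfolds at the first step, whereas the closed loop advances at
the last; iterates allow both. -/
lemma innovationSeq_eq_iterate (G : S → ℝ → S) (τ : S → ℝ) (s : S) (g : ℕ → ℝ) (n : ℕ) :
    innovationSeq G τ s g n
      = innovation (τ ((filterStep G τ)^[n] (s, g)).1) ((filterStep G τ)^[n] (s, g)).2 := by
  induction n generalizing s g with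
  | zero => rfl
  | succ n ih => exact ih _ _

lemma orbit_innovationSeq_eq_iterate (G : S → ℝ → S) (τ : S → ℝ) (s : S) (g : ℕ → ℝ) (n : ℕ) :
    orbit G s (innovationSeq G τ s g) n = ((filterStep G τ)^[n] (s, g)).1 := by
  induction n generalizing s g with
  | zero => rfl
  | succ n ih => exact ih _ _

end FilterStep

/-- The signal-to-noise ratio `φ √P` of the next output, in terms of the state `(φ, 1 / P)`. -/
noncomputable def signalRatio (s : ℝ × ℝ) : ℝ := s.1 / √s.2

@[fun_prop] lemma measurable_signalRatio : Measurable signalRatio := by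
  unfold signalRatio; fun_prop

lemma one_add_signalRatio_sq {s : ℝ × ℝ} (hs : 0 < s.2) : 1 + signalRatio s ^ 2 = outputVar s := by
  rw [signalRatio, outputVar, div_pow, Real.sq_sqrt hs.le]

lemma lsState_succ (f : ℝ → ℝ) (θ₀ P₀ : ℝ) (y : ℕ → ℝ) (t : ℕ) :
    lsState f θ₀ P₀ (t + 1) (fun i => y i) =
      ((lsState f θ₀ P₀ t fun i => y i).1 +
        (1 + f (y t) * (lsState f θ₀ P₀ t fun i => y i).2 * f (y t))⁻¹ *
          (lsState f θ₀ P₀ t fun i => y i).2 * f (y t) *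
          (y (t + 1) - -(lsState f θ₀ P₀ t fun i => y i).1 * f (y t) -
            f (y t) * (lsState f θ₀ P₀ t fun i => y i).1),
        (lsState f θ₀ P₀ t fun i => y i).2 -
          (1 + f (y t) * (lsState f θ₀ P₀ t fun i => y i).2 * f (y t))⁻¹ *
          (lsState f θ₀ P₀ t fun i => y i).2 * f (y t) * f (y t) *
          (lsState f θ₀ P₀ t fun i => y i).2) := rfl

lemma measurable_lsState {f : ℝ → ℝ} (hf : Measurable f) (θ₀ P₀ : ℝ) (t : ℕ) :
    Measurable (lsState f θ₀ P₀ t) := by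
  induction t with
  | zero => exact measurable_const
  | succ t ih =>
    have hpast : Measurable fun h : Fin (t + 2) → ℝ => fun i : Fin (t + 1) => h i.castSucc :=
      measurable_pi_lambda _ fun i => measurable_pi_apply _
    have h1 := (ih.comp hpast).fst
    have h2 := (ih.comp hpast).snd
    have h3 : Measurable fun h : Fin (t + 2) → ℝ => f (h (Fin.last t).castSucc) :=
      hf.comp (measurable_pi_apply _)
    have h4 : Measurable fun h : Fin (t + 2) → ℝ => h (Fin.last (t + 1)) := measurable_pi_apply _
    have h5 := (((h3.mul h2).mul h3).const_add 1).inv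
    exact (h1.add (((h5.mul h2).mul h3).mul ((h4.sub (h1.neg.mul h3)).sub (h3.mul h1)))).prodMk
      (h2.sub ((((h5.mul h2).mul h3).mul h3).mul h2))

lemma isFeedbackLaw_lsControl {f : ℝ → ℝ} (hf : Measurable f) (θ₀ P₀ : ℝ) :
    IsFeedbackLaw (lsControl f θ₀ P₀) := fun t =>
  (measurable_lsState hf θ₀ P₀ t).fst.neg.mul (hf.comp (measurable_pi_apply _))

/-- The update of the normalized estimation error `z` is the passage to the residual. -/
lemma kalman_update {P φ z w : ℝ} (hP : 0 < P) :
    0 < P - (1 + φ * P * φ)⁻¹ * P * φ * φ * P ∧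
    1 / P + φ ^ 2 = 1 / (P - (1 + φ * P * φ)⁻¹ * P * φ * φ * P) ∧
    √P * z - (1 + φ * P * φ)⁻¹ * P * φ * (φ * (√P * z) + w) =
      √(P - (1 + φ * P * φ)⁻¹ * P * φ * φ * P) *
        ((z - signalRatio (φ, 1 / P) * w) / √(1 + signalRatio (φ, 1 / P) ^ 2)) := by
  have hσ : 0 < 1 + φ * P * φ := by nlinarith [mul_nonneg hP.le (sq_nonneg φ)]
  have hP' : P - (1 + φ * P * φ)⁻¹ * P * φ * φ * P = P / (1 + φ * P * φ) := by
    field_simp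
    ring
  have hτ : signalRatio (φ, 1 / P) = φ * √P := by
    simp [signalRatio, Real.sqrt_inv]
  have hτ2 : 1 + (φ * √P) ^ 2 = 1 + φ * P * φ := by
    rw [mul_pow, Real.sq_sqrt hP.le]; ring
  rw [hP', hτ, hτ2, Real.sqrt_div' _ hσ.le]
  refine ⟨by positivity, by field_simp, ?_⟩
  have hs : √(1 + φ * P * φ) * √(1 + φ * P * φ) = 1 + φ * P * φ := Real.mul_self_sqrt hσ.le
  have hsP : √P * √P = P := Real.mul_self_sqrt hP.le
  rw [div_mul_div_comm, hs]
  field_simp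
  linear_combination (φ * w) * hsP

/-- In closed loop with the certainty-equivalence control, the filter attached to the normalized noise
`(θ - θ₀) / √P₀, w₁, w₂, …` tracks the regressor, the information, the estimation error and the noise. -/
lemma filterStep_iterate_eq {f : ℝ → ℝ} {θ θ₀ P₀ : ℝ} (hP₀ : 0 < P₀) {w y : ℕ → ℝ}
    (hy : ∀ t, y (t + 1) = θ * f (y t) + lsControl f θ₀ P₀ t (fun i => y i) + w (t + 1)) (t : ℕ) :
    0 < (lsState f θ₀ P₀ t fun i => y i).2 ∧
    ∃ g : ℕ → ℝ, (filterStep (nextState f) signalRatio)^[t]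
        ((f (y 0), 1 / P₀), consSeq ((θ - θ₀) / √P₀) fun t => w (t + 1))
      = ((f (y t), 1 / (lsState f θ₀ P₀ t fun i => y i).2), g) ∧
      θ - (lsState f θ₀ P₀ t fun i => y i).1 = √(lsState f θ₀ P₀ t fun i => y i).2 * g 0 ∧
      (∀ k, g (k + 1) = w (t + k + 1)) ∧
      y (t + 1) = √(outputVar (f (y t), 1 / (lsState f θ₀ P₀ t fun i => y i).2)) *
        innovation (signalRatio (f (y t), 1 / (lsState f θ₀ P₀ t fun i => y i).2)) g := by
  have hout : ∀ (t : ℕ) (g : ℕ → ℝ), 0 < (lsState f θ₀ P₀ t fun i => y i).2 →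
      θ - (lsState f θ₀ P₀ t fun i => y i).1 = √(lsState f θ₀ P₀ t fun i => y i).2 * g 0 →
      (∀ k, g (k + 1) = w (t + k + 1)) →
      y (t + 1) = √(outputVar (f (y t), 1 / (lsState f θ₀ P₀ t fun i => y i).2)) *
        innovation (signalRatio (f (y t), 1 / (lsState f θ₀ P₀ t fun i => y i).2)) g := by
    intro t g hP herr hg
    set P := (lsState f θ₀ P₀ t fun i => y i).2
    have hs : 0 < ((f (y t), 1 / P) : ℝ × ℝ).2 := by simpa using hP
    have hpos := one_pos.trans_le (one_le_sqrt_outputVar hs)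
    have hτ : signalRatio (f (y t), 1 / P) = f (y t) * √P := by
      simp [signalRatio, Real.sqrt_inv]
    rw [innovation, one_add_signalRatio_sq hs, mul_div_cancel₀ _ hpos.ne', hy t, hτ, hg 0]
    have : lsControl f θ₀ P₀ t (fun i => y i) = -(lsState f θ₀ P₀ t fun i => y i).1 * f (y t) := rfl
    rw [this]
    linear_combination f (y t) * herr
  induction t with
  | zero =>
    have h0 : lsState f θ₀ P₀ 0 (fun i => y i) = (θ₀, P₀) := rfl
    have hsq : √P₀ ≠ 0 := (Real.sqrt_pos.2 hP₀).ne'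
    have herr : θ - (lsState f θ₀ P₀ 0 fun i => y i).1 = √(lsState f θ₀ P₀ 0 fun i => y i).2 *
        consSeq ((θ - θ₀) / √P₀) (fun t => w (t + 1)) 0 := by
      rw [h0, consSeq_zero, mul_div_cancel₀ _ hsq]
    have hg : ∀ k, consSeq ((θ - θ₀) / √P₀) (fun t => w (t + 1)) (k + 1) = w (0 + k + 1) := by simp
    exact ⟨hP₀, _, rfl, herr, hg, hout 0 _ hP₀ herr hg⟩
  | succ t ih =>
    obtain ⟨hP, g, hit, herr, hg, hyt⟩ := ih
    set P := (lsState f θ₀ P₀ t fun i => y i).2 with hPdef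
    obtain ⟨hP', hinfo, hupd⟩ := kalman_update (φ := f (y t)) (z := g 0) (w := w (t + 1)) hP
    have h1 : (lsState f θ₀ P₀ (t + 1) fun i => y i).2
        = P - (1 + f (y t) * P * f (y t))⁻¹ * P * f (y t) * f (y t) * P := rfl
    rw [← h1] at hP' hinfo hupd
    have herr' : θ - (lsState f θ₀ P₀ (t + 1) fun i => y i).1
        = √(lsState f θ₀ P₀ (t + 1) fun i => y i).2 *
          residualSeq (signalRatio (f (y t), 1 / P)) g 0 := by
      have hu : lsControl f θ₀ P₀ t (fun i => y i)
          = -(lsState f θ₀ P₀ t fun i => y i).1 * f (y t) := rfl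
      rw [residualSeq, consSeq_zero, hg 0, add_zero, ← hupd, ← herr, lsState_succ, ← hPdef,
        hy t, hu]
      ring
    have hg' : ∀ k, residualSeq (signalRatio (f (y t), 1 / P)) g (k + 1) = w (t + 1 + k + 1) := by
      intro k
      rw [residualSeq, consSeq_succ, tailSeq_apply, tailSeq_apply, hg]
      congr 1
      omega
    refine ⟨hP', residualSeq (signalRatio (f (y t), 1 / P)) g, ?_, herr', hg',
      hout (t + 1) _ hP' herr' hg'⟩
    rw [Function.iterate_succ_apply', hit, filterStep]
    simp only [nextState]
    rw [← hyt, ← hinfo]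

/-! ### From bounded variances to stability -/

/-- In closed loop the outputs are the innovations scaled by the conditional standard deviations. -/
lemma output_eq_sqrt_outputVar_mul_innovationSeq {f : ℝ → ℝ} {θ θ₀ P₀ : ℝ} (hP₀ : 0 < P₀)
    {w y : ℕ → ℝ}
    (hy : ∀ t, y (t + 1) = θ * f (y t) + lsControl f θ₀ P₀ t (fun i => y i) + w (t + 1))
    {e : ℕ → ℝ} (he : e = innovationSeq (nextState f) signalRatio (f (y 0), 1 / P₀)
      (consSeq ((θ - θ₀) / √P₀) fun t => w (t + 1))) (t : ℕ) :
    y (t + 1) = √(outputVar (orbit (nextState f) (f (y 0), 1 / P₀) e t)) * e t := by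
  obtain ⟨_, g, hit, _, _, hyt⟩ := filterStep_iterate_eq hP₀ hy t
  rw [he, orbit_innovationSeq_eq_iterate, innovationSeq_eq_iterate, hit]
  exact hyt

lemma outputVar_orbit_nonneg {f : ℝ → ℝ} {s : ℝ × ℝ} (hs : 0 < s.2) (e : ℕ → ℝ) (n : ℕ) :
    0 ≤ outputVar (orbit (nextState f) s e n) := by
  induction n generalizing s e with
  | zero => exact outputVar_nonneg hs
  | succ n ih => exact ih (s := nextState f s (e 0)) (add_pos_of_pos_of_nonneg hs (sq_nonneg _)) _

lemma average_sq_le_of_mem_boundedVar {f : ℝ → ℝ} {s : ℝ × ℝ} (hs : 0 < s.2) {y e : ℕ → ℝ}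
    (hy : ∀ t, y (t + 1) = √(outputVar (orbit (nextState f) s e t)) * e t)
    (he : e ∈ boundedVar f s) {C : ℝ} (hC : ∀ n : ℕ, ∑ i ∈ Finset.range n, e i ^ 2 ≤ C * n) :
    ∃ C : ℝ, ∀ t : ℕ, 1 ≤ t → (1 / (t : ℝ)) * ∑ i ∈ Finset.Icc 1 t, y i ^ 2 ≤ C := by
  obtain ⟨K, hK⟩ := he
  refine ⟨K * C, fun t ht => ?_⟩
  have ht0 : (0 : ℝ) < t := by exact_mod_cast ht
  have hsum : ∑ i ∈ Finset.Icc 1 t, y i ^ 2 = ∑ i ∈ Finset.range t, y (i + 1) ^ 2 := by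
    rw [Finset.sum_bij' (fun i _ => i - 1) (fun i _ => i + 1)] <;> intro i hi <;>
      simp only [Finset.mem_Icc, Finset.mem_range] at * <;> first | omega | skip
    rw [Nat.sub_add_cancel hi.1]
  have hle : ∑ i ∈ Finset.range t, y (i + 1) ^ 2 ≤ K * (C * t) := by
    refine le_trans (Finset.sum_le_sum (g := fun i => K * e i ^ 2) fun i _ => ?_) ?_
    · rw [hy, mul_pow, Real.sq_sqrt (outputVar_orbit_nonneg hs e i)]
      exact mul_le_mul_of_nonneg_right (hK i) (sq_nonneg _)
    · rw [← Finset.mul_sum]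
      exact mul_le_mul_of_nonneg_left (hC t) K.cast_nonneg
  rw [hsum, one_div, inv_mul_le_iff₀ ht0]
  linarith

lemma map_standardize_gaussianReal (m : ℝ) {v : ℝ≥0} (hv : 0 < v) :
    MeasurePreserving (fun x => (x - m) / √v) (gaussianReal m v) (gaussianReal 0 1) := by
  refine ⟨by fun_prop, ?_⟩
  have h : (fun x : ℝ => (x - m) / √v) = (fun x => x / √v) ∘ fun x => x - m := rfl
  rw [h, ← Measure.map_map (by fun_prop) (by fun_prop), gaussianReal_map_sub_const,
    gaussianReal_map_div_const]
  congr 1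
  · simp
  · ext
    simp [hv.ne', Real.sq_sqrt v.coe_nonneg]

/-- The initial value and the innovations of the least-squares algorithm are independent, and the
innovations are independent standard Gaussian random variables. -/
lemma measurePreserving_initial_innovationSeq {Ω : Type*} [MeasurableSpace Ω] {μ : Measure Ω}
    [IsProbabilityMeasure μ] {f : ℝ → ℝ} (hf : Measurable f) {θ : Ω → ℝ} {w : ℕ → Ω → ℝ}
    {θ₀ : ℝ} {P₀ : ℝ≥0} (hP₀ : 0 < P₀) (hw_meas : ∀ t : ℕ, Measurable (w (t + 1)))
    (hw_indep : iIndepFun (fun t : ℕ => w (t + 1)) μ)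
    (hw_law : ∀ t : ℕ, μ.map (w (t + 1)) = gaussianReal 0 1)
    (hθ_meas : Measurable θ) (hθ_law : μ.map θ = gaussianReal θ₀ P₀)
    (hθ_indep : IndepFun θ (fun ω => fun t : ℕ => w (t + 1) ω) μ)
    {Y : Ω → ℝ} (hY : Measurable Y)
    (hY_indep : IndepFun Y (fun ω => (θ ω, fun t : ℕ => w (t + 1) ω)) μ) (r : ℝ) :
    MeasurePreserving (fun ω => (Y ω, innovationSeq (nextState f) signalRatio (f (Y ω), r)
      (consSeq ((θ ω - θ₀) / √P₀) fun t => w (t + 1) ω))) μ ((μ.map Y).prod gaussianSeq) := by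
  have hwm : Measurable fun ω => fun t : ℕ => w (t + 1) ω := measurable_pi_lambda _ hw_meas
  have hw : μ.map (fun ω => fun t : ℕ => w (t + 1) ω) = gaussianSeq := by
    rw [hw_indep.map_fun_eq_infinitePi_map hw_meas]
    simp only [hw_law]
    rfl
  have hprob : IsProbabilityMeasure (μ.map Y) := Measure.isProbabilityMeasure_map hY.aemeasurable
  have h0 : MeasurePreserving (fun ω => (Y ω, (θ ω, fun t : ℕ => w (t + 1) ω))) μ
      ((μ.map Y).prod ((gaussianReal θ₀ P₀).prod gaussianSeq)) := by
    refine ⟨hY.prodMk (hθ_meas.prodMk hwm), ?_⟩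
    rw [(indepFun_iff_map_prod_eq_prod_map_map hY.aemeasurable
      (hθ_meas.prodMk hwm).aemeasurable).1 hY_indep,
      (indepFun_iff_map_prod_eq_prod_map_map hθ_meas.aemeasurable hwm.aemeasurable).1 hθ_indep,
      hθ_law, hw]
  have h1 := (MeasurePreserving.id (μ.map Y)).prod
    ((map_standardize_gaussianReal θ₀ hP₀).prod (MeasurePreserving.id gaussianSeq))
  have h2 := (MeasurePreserving.id (μ.map Y)).prod (measurePreserving_consSeq (gaussianReal 0 1))
  have hinn := measurable_innovationSeq (measurable_nextState hf) measurable_signalRatio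
  -- The innovations depend on the initial value through the starting state, but their law does not;
  -- hence they are independent of it.
  have h3 := (MeasurePreserving.id (μ.map Y)).skew_product
    (g := fun x g => innovationSeq (nextState f) signalRatio (f x, r) g)
    (hinn.comp (((hf.comp measurable_fst).prodMk measurable_const).prodMk measurable_snd))
    (Eventually.of_forall fun x => (measurePreserving_innovationSeq (measurable_nextState hf)
      measurable_signalRatio (f x, r)).map_eq)
  exact h3.comp (h2.comp (h1.comp h0))

/-- The least-squares certainty-equivalence control stabilizes the system. -/
theorem stabilizes_lsControl {Ω : Type*} [MeasurableSpace Ω] {μ : Measure Ω}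
    [IsProbabilityMeasure μ] {f : ℝ → ℝ} (hf : Measurable f) {θ : Ω → ℝ} {w : ℕ → Ω → ℝ}
    {θ₀ : ℝ} {P₀ : ℝ≥0} (hP₀ : 0 < P₀) (hw_meas : ∀ t : ℕ, Measurable (w (t + 1)))
    (hw_indep : iIndepFun (fun t : ℕ => w (t + 1)) μ)
    (hw_law : ∀ t : ℕ, μ.map (w (t + 1)) = gaussianReal 0 1)
    (hθ_meas : Measurable θ) (hθ_law : μ.map θ = gaussianReal θ₀ P₀)
    (hθ_indep : IndepFun θ (fun ω => fun t : ℕ => w (t + 1) ω) μ)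
    {k₁ k₂ : ℝ} (hk₂ : 0 < k₂) (hfk : ∀ x, |f x| ≤ k₁ * Real.exp (k₂ * |x|))
    {b L : ℝ} (hb : b < 4) (hL : 0 < L) (hliminf : 0 < liminf
      (fun l : ℝ => volume (growthSet f b L ∩ Set.Icc (-l) l) / ENNReal.ofReal l) atTop) :
    Stabilizes μ f θ w (lsControl f θ₀ P₀) := by
  intro y hy0 hyindep hloop
  have hP : (0 : ℝ) < P₀ := hP₀
  have hr : (0 : ℝ) < 1 / P₀ := by positivity
  have hmp := measurePreserving_initial_innovationSeq hf hP₀ hw_meas hw_indep hw_law hθ_meas hθ_law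
    hθ_indep hy0 hyindep (1 / P₀)
  have hprob : IsProbabilityMeasure (μ.map (y 0)) := Measure.isProbabilityMeasure_map hy0.aemeasurable
  have hbdd : ∀ᵐ p ∂(μ.map (y 0)).prod gaussianSeq, p.2 ∈ boundedVar f (f p.1, 1 / P₀) := by
    have hm : MeasurableSet {p : ℝ × (ℕ → ℝ) | p.2 ∈ boundedVar f (f p.1, 1 / P₀)} := by
      have : {p : ℝ × (ℕ → ℝ) | p.2 ∈ boundedVar f (f p.1, 1 / P₀)} = ⋃ K : ℕ, ⋂ n,
          {p | outputVar (orbit (nextState f) (f p.1, 1 / P₀) p.2 n) ≤ K} := by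
        ext p; simp [boundedVar]
      rw [this]
      refine .iUnion fun K => .iInter fun n => measurableSet_le ?_ measurable_const
      exact measurable_outputVar.comp ((measurable_orbit (measurable_nextState hf) n).comp
        (((hf.comp measurable_fst).prodMk measurable_const).prodMk measurable_snd))
    -- By Fubini the initial value may be frozen, which reduces the claim to a deterministic
    -- starting state.
    refine (Measure.ae_prod_mem_iff_ae_ae_mem hm).2 (Eventually.of_forall fun x => ?_)
    exact ae_mem_boundedVar hf hk₂ hfk hb hL hliminf (f x, 1 / P₀) hr
  have hsq : ∀ᵐ p ∂(μ.map (y 0)).prod gaussianSeq,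
      ∃ C : ℝ, ∀ n : ℕ, ∑ i ∈ Finset.range n, p.2 i ^ 2 ≤ C * n :=
    Measure.quasiMeasurePreserving_snd.ae ae_exists_sum_sq_le
  filter_upwards [hmp.quasiMeasurePreserving.ae hbdd, hmp.quasiMeasurePreserving.ae hsq]
    with ω h1 ⟨C, hC⟩
  exact average_sq_le_of_mem_boundedVar (y := fun t => y t ω) hr
    (output_eq_sqrt_outputVar_mul_innovationSeq (y := fun t => y t ω) (w := fun t => w t ω) hP
      (fun t => hloop t ω) rfl) h1 hC

theorem theorem2p1 {Ω : Type*} [MeasurableSpace Ω] (μ : Measure Ω) [IsProbabilityMeasure μ]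
    (f : ℝ → ℝ) (hf : PiecewiseContinuous f)
    (θ : Ω → ℝ) (w : ℕ → Ω → ℝ) (θ₀ : ℝ) (P₀ : ℝ≥0) (hP₀ : 0 < P₀)
    (hw_meas : ∀ t : ℕ, Measurable (w (t + 1)))
    (hw_indep : iIndepFun (fun t : ℕ => w (t + 1)) μ)
    (hw_law : ∀ t : ℕ, μ.map (w (t + 1)) = gaussianReal 0 1)
    (hθ_meas : Measurable θ)
    (hθ_law : μ.map θ = gaussianReal θ₀ P₀)
    (hθ_indep : IndepFun θ (fun ω => fun t : ℕ => w (t + 1) ω) μ)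
    (h_exp : ∃ k₁ k₂ : ℝ, 0 < k₁ ∧ 0 < k₂ ∧ ∀ x : ℝ, |f x| ≤ k₁ * Real.exp (k₂ * |x|))
    (h_density : ∃ b L : ℝ, b < 4 ∧ 0 < L ∧
      0 < liminf
        (fun l : ℝ => volume (growthSet f b L ∩ Set.Icc (-l) l) / ENNReal.ofReal l) atTop) :
    GloballyStabilizable μ f θ w ∧
      IsFeedbackLaw (lsControl f θ₀ P₀) ∧ Stabilizes μ f θ w (lsControl f θ₀ P₀) := by
  obtain ⟨k₁, k₂, _, hk₂, hfk⟩ := h_exp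
  obtain ⟨b, L, hb, hL, hliminf⟩ := h_density
  have hlaw := isFeedbackLaw_lsControl hf.measurable θ₀ P₀
  have hstab := stabilizes_lsControl hf.measurable hP₀ hw_meas hw_indep hw_law hθ_meas hθ_law
    hθ_indep hk₂ hfk hb hL hliminf
  exact ⟨⟨_, hlaw, hstab⟩, hlaw, hstab⟩
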